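/- Let $G$ be a compact Lie group, and let $\tau$ be a (continuous, finite-dimensional, complex) irreducible representation of $G$ whose character $\chi^\tau$ is not real valued. Let $\bar\tau$ be the complex conjugate representation and, for an irreducible representation $\phi$ of $G$, let $m_\phi[(\tau+\bar\tau)^2]$ denote the multiplicity of $\phi$ in $(\tau\oplus\bar\tau)\otimes(\tau\oplus\bar\tau)$. Let $\alpha\in G$, $\alpha\neq 1$, be such that $\alpha$ and $\alpha^{-1}$ are conjugate in $G$. Then $\chi^\tau(\alpha)$ and all $\chi^\phi(\alpha)$ are real and only finitely many of the multiplicities $m_\phi[(\tau+\bar\tau)^2]$ are non-zero. Put $a=1-\frac{\chi^\tau(\alpha)}{\dim(\tau)}$ and assume $a\neq 0$. Let $W=\frac{1}{\sqrt2}\left(\chi^\tau(g)+\overline{\chi^\tau(g)}\right)$, where $g$ is chosen from the normalized Haar measure of $G$. Then for all real $x_0$, \[ \left|\mathbb{P}(W\le x_0)-\frac{1}{\sqrt{2\pi}}\int_{-\infty}^{x_0}e^{-x^2/2}\,dx\right| \le \frac12\sqrt{\sum_{\phi}^{\ \ *} m_\phi[(\tau+\bar\tau)^2]^2\left[2-\frac1a\left(1-\frac{\chi^\phi(\alpha)}{\dim(\phi)}\right)\right]^2}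 +\left[\frac1\pi\sum_\phi m_\phi[(\tau+\bar\tau)^2]^2\left(2-\frac{3}{2a}\left(1-\frac{\chi^\phi(\alpha)}{\dim(\phi)}\right)\right)\right]^{1/4}. \] Here the second sum is over all irreducible representations $\phi$ of $G$ up to isomorphism, and the first (starred) sum is over the non-trivial ones. -/

import Mathlib

open scoped Manifold ContDiff TensorProduct ComplexConjugate

noncomputable section

/-- The action map `G × V → V` of the representation `ρ` is continuous. -/
def Representation.IsContinuousAction {G V : Type*} [Monoid G] [TopologicalSpace G]
    [AddCommGroup V] [Module ℂ V] [TopologicalSpace V] (ρ : Representation ℂ G V) : Prop :=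
  Continuous fun p : G × V => ρ p.1 p.2

/-- The complex conjugate of a complex vector space `V`: the same additive group, with the scalar
`c` acting as the conjugate of `c` acts on `V`. -/
def ConjSpace (V : Type*) : Type _ := V

instance ConjSpace.instAddCommGroup (V : Type*) [AddCommGroup V] : AddCommGroup (ConjSpace V) :=
  inferInstanceAs (AddCommGroup V)

instance ConjSpace.instModule (V : Type*) [AddCommGroup V] [Module ℂ V] :
    Module ℂ (ConjSpace V) :=
  Module.compHom V (starRingEnd ℂ)

/-- The complex conjugate of a representation: every group element acts by the same map, on the
conjugate vector space. -/
def Representation.conjRep {G V : Type*} [Monoid G] [AddCommGroup V] [Module ℂ V]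
    (ρ : Representation ℂ G V) : Representation ℂ G (ConjSpace V) where
  toFun g :=
    { toFun := fun v => ρ g (show V from v)
      map_add' := fun v w => (ρ g).map_add v w
      map_smul' := fun c v => (ρ g).map_smul (conj c) (show V from v) }
  map_one' := by
    apply LinearMap.ext
    intro v
    show ρ 1 (show V from v) = v
    rw [map_one]
    rfl
  map_mul' g h := by
    apply LinearMap.ext
    intro v
    show ρ (g * h) (show V from v) = ρ g (ρ h (show V from v))
    rw [map_mul]
    rfl

/-- The multiplicity of an irreducible complex representation `σ` in a finite-dimensional
completely reducible representation `ρ`: the dimension of `Hom_G(σ, ρ)`. -/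
def Representation.multiplicity {G V W : Type*} [Monoid G] [AddCommGroup V] [Module ℂ V]
    [AddCommGroup W] [Module ℂ W] (σ : Representation ℂ G V) (ρ : Representation ℂ G W) : ℕ :=
  Module.finrank ℂ (Representation.IntertwiningMap σ ρ)

/-- A continuous irreducible finite-dimensional complex representation of `G`, in coordinates. -/
structure IrrepModel (G : Type*) [Group G] [TopologicalSpace G] where
  n : ℕ
  rep : Representation ℂ G (Fin n → ℂ)
  continuous_rep : rep.IsContinuousAction
  irreducible_rep : rep.IsIrreducible

/-- Isomorphism of representations. -/
instance IrrepModel.instSetoid (G : Type*) [Group G] [TopologicalSpace G] :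
    Setoid (IrrepModel G) where
  r σ ρ := Nonempty (σ.rep.Equiv ρ.rep)
  iseqv :=
    { refl := fun _ => ⟨Representation.Equiv.refl _⟩
      symm := fun ⟨e⟩ => ⟨e.symm⟩
      trans := fun ⟨e⟩ ⟨f⟩ => ⟨e.trans f⟩ }

/-- The isomorphism classes of continuous irreducible finite-dimensional complex representations
of `G`. -/
def Irr (G : Type*) [Group G] [TopologicalSpace G] : Type _ :=
  Quotient (IrrepModel.instSetoid G)

namespace Irr

variable {G : Type*} [Group G] [TopologicalSpace G]

/-- The character of an isomorphism class of irreducible representations. -/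
def char (φ : Irr G) : G → ℂ :=
  Quotient.lift (fun σ : IrrepModel G => σ.rep.character)
    (by
      rintro _ _ ⟨e⟩
      exact Representation.char_iso e) φ

/-- The dimension of an isomorphism class of irreducible representations. -/
def dim (φ : Irr G) : ℕ :=
  Quotient.lift (fun σ : IrrepModel G => Module.finrank ℂ (Fin σ.n → ℂ))
    (by
      rintro _ _ ⟨e⟩
      exact e.toLinearEquiv.finrank_eq) φ

/-- The character ratio of `φ` at `α`. -/
def charRatio (φ : Irr G) (α : G) : ℂ := φ.char α / (φ.dim : ℂ)

/-- The class of the trivial representation: every group element acts as the identity. -/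
def IsTriv (φ : Irr G) : Prop :=
  Quotient.lift (fun σ : IrrepModel G => ∀ g v, σ.rep g v = v)
    (by
      have key : ∀ σ ρ : IrrepModel G, σ.rep.Equiv ρ.rep →
          (∀ g v, σ.rep g v = v) → ∀ g v, ρ.rep g v = v := by
        intro σ ρ e h g v
        have h1 := LinearMap.congr_fun (e.symm.toIntertwiningMap.isIntertwining' g) v
        apply e.symm.toLinearEquiv.injective
        exact h1.trans (h g _)
      rintro σ ρ ⟨e⟩
      exact propext ⟨key σ ρ e, key ρ σ e.symm⟩) φ

/-- The multiplicity of `φ` in the representation `ρ`. -/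
def mult {W : Type*} [AddCommGroup W] [Module ℂ W] (φ : Irr G) (ρ : Representation ℂ G W) : ℕ :=
  Quotient.lift (fun σ : IrrepModel G => σ.rep.multiplicity ρ)
    (by
      rintro σ σ' ⟨e⟩
      refine LinearEquiv.finrank_eq
        (LinearEquiv.ofLinearMap
          { toFun := fun f => f.comp e.symm.toIntertwiningMap
            map_add' := fun _ _ => rfl
            map_smul' := fun _ _ => rfl }
          { toFun := fun f => f.comp e.toIntertwiningMap
            map_add' := fun _ _ => rfl
            map_smul' := fun _ _ => rfl } ?_ ?_)
      · apply LinearMap.ext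
        intro f
        apply Representation.IntertwiningMap.ext
        apply LinearMap.ext
        intro v
        exact congrArg (fun x => f x) (e.toLinearEquiv.apply_symm_apply v)
      · apply LinearMap.ext
        intro f
        apply Representation.IntertwiningMap.ext
        apply LinearMap.ext
        intro v
        exact congrArg (fun x => f x) (e.toLinearEquiv.symm_apply_apply v)) φ

end Irr

/-- The representation `(τ + τ̄)²`, i.e. `(τ ⊕ τ̄) ⊗ (τ ⊕ τ̄)`. -/
def Representation.sumConjSq {G V : Type*} [Monoid G] [AddCommGroup V] [Module ℂ V]
    (τ : Representation ℂ G V) :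
    Representation ℂ G ((V × ConjSpace V) ⊗[ℂ] (V × ConjSpace V)) :=
  (τ.prod τ.conjRep).tprod (τ.prod τ.conjRep)

/-- The random variable `W(g) = (χ(g) + conj χ(g)) / √2`, with values in the reals. -/
def Representation.symmTrace {G V : Type*} [Monoid G] [AddCommGroup V] [Module ℂ V]
    (τ : Representation ℂ G V) (g : G) : ℝ :=
  (τ.character g + conj (τ.character g)).re / √2

end

/-! Stein's method for the exchangeable pair `W g` and `W' = W (g * h * α * h⁻¹)`, where `g` and `h`
are independent and Haar distributed; the pair is exchangeable because `α` and `α⁻¹` are conjugate.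
By Schur's lemma, averaging `χ (g * h * α * h⁻¹)` over `h` multiplies an irreducible character `χ`
by its normalised value at `α`. Hence `E[W' | g] = (1 - a) * W`, and since `W ^ 2` is half the
character of `(τ + τ̄)²`, both `E[(W' - W) ^ 2 | g]` and `E[(W' - W) ^ 4]` are explicit in the
multiplicities by orthogonality of characters. Replacing the indicator of `(-∞, x₀]` by a ramp of
slope `L` costs an error of order `1 / L`, while the Taylor remainder in Stein's argument grows
linearly in `L`; optimising over `L` turns the fourth moment into the fourth root term. -/

noncomputable section

section Gaussian

open MeasureTheory ProbabilityTheory Set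

theorem hasDerivAt_gaussianPDFReal_zero_one (t : ℝ) :
    HasDerivAt (gaussianPDFReal 0 1) (-(t * gaussianPDFReal 0 1 t)) t := by
  have hexp : HasDerivAt (fun t : ℝ => -(t - 0) ^ 2 / (2 * ((1 : NNReal) : ℝ))) (-t) t := by
    convert! (((hasDerivAt_id t).sub_const 0).pow 2).neg.div_const (2 * ((1 : NNReal) : ℝ)) using 1
    simp only [id, NNReal.coe_one]
    ring
  convert! hexp.exp.const_mul (√(2 * Real.pi * ((1 : NNReal) : ℝ)))⁻¹ using 1
  rw [gaussianPDFReal]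
  ring

theorem gaussianPDFReal_zero_one_le (t : ℝ) : gaussianPDFReal 0 1 t ≤ 1 / √(2 * Real.pi) := by
  rw [gaussianPDFReal, NNReal.coe_one, mul_one, one_div]
  exact mul_le_of_le_one_right (by positivity)
    (Real.exp_le_one_iff.2 (by linarith [sq_nonneg (t - 0)]))

theorem setIntegral_gaussianReal {μ : ℝ} {v : NNReal} (hv : v ≠ 0) (s : Set ℝ) (f : ℝ → ℝ) :
    ∫ t in s, f t ∂gaussianReal μ v = ∫ t in s, gaussianPDFReal μ v t * f t := by
  rw [gaussianReal_of_var_ne_zero _ hv, setIntegral_withDensity_eq_setIntegral_toReal_smul'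
    s (measurable_gaussianPDF _ _) (ae_of_all _ fun _ => gaussianPDF_lt_top)]
  simp only [toReal_gaussianPDF, smul_eq_mul]

theorem integrable_gaussianReal_iff {μ : ℝ} {v : NNReal} (hv : v ≠ 0) {f : ℝ → ℝ} :
    Integrable f (gaussianReal μ v) ↔ Integrable fun t => gaussianPDFReal μ v t * f t := by
  rw [gaussianReal_of_var_ne_zero _ hv, integrable_withDensity_iff_integrable_smul'
    (measurable_gaussianPDF _ _) (ae_of_all _ fun _ => gaussianPDF_lt_top)]
  simp only [toReal_gaussianPDF, smul_eq_mul]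

theorem integrable_id_gaussianReal (μ : ℝ) (v : NNReal) :
    Integrable (fun t => t) (gaussianReal μ v) :=
  (memLp_id_gaussianReal 1).integrable le_rfl

theorem integral_Ioi_gaussianReal_deriv_sub_mul {p p' : ℝ → ℝ} (w : ℝ)
    (hp : ∀ t, HasDerivAt p (p' t) t) (hpi : Integrable p (gaussianReal 0 1))
    (hpi' : Integrable (fun t => p' t - t * p t) (gaussianReal 0 1)) :
    ∫ t in Ioi w, (p' t - t * p t) ∂gaussianReal 0 1 = -(gaussianPDFReal 0 1 w * p w) := by
  have hderiv (t : ℝ) : HasDerivAt (fun t => gaussianPDFReal 0 1 t * p t)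
      (gaussianPDFReal 0 1 t * (p' t - t * p t)) t := by
    convert! (hasDerivAt_gaussianPDFReal_zero_one t).mul (hp t) using 1
    ring
  have hint := ((integrable_gaussianReal_iff one_ne_zero).1 hpi').integrableOn (s := Ioi w)
  have hlim := tendsto_zero_of_hasDerivAt_of_integrableOn_Ioi (fun t _ => hderiv t) hint
    ((integrable_gaussianReal_iff one_ne_zero).1 hpi).integrableOn
  rw [setIntegral_gaussianReal one_ne_zero,
    integral_Ioi_of_hasDerivAt_of_tendsto' (fun t _ => hderiv t) hint hlim, zero_sub]

theorem integral_Ioi_id_gaussianReal (w : ℝ) :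
    ∫ t in Ioi w, t ∂gaussianReal 0 1 = gaussianPDFReal 0 1 w := by
  have h := integral_Ioi_gaussianReal_deriv_sub_mul w (fun t => hasDerivAt_const t (1 : ℝ))
    (integrable_const _)
    (by simpa only [mul_one, zero_sub] using (integrable_id_gaussianReal 0 1).fun_neg)
  rw [← neg_inj, ← integral_neg]
  simpa only [mul_one, zero_sub] using h

theorem mul_gaussianReal_Ioi_le (w : ℝ) :
    w * (gaussianReal 0 1).real (Ioi w) ≤ gaussianPDFReal 0 1 w := by
  rw [← integral_Ioi_id_gaussianReal, mul_comm, ← smul_eq_mul, ← setIntegral_const]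
  exact setIntegral_mono_on (integrable_const w).integrableOn
    (integrable_id_gaussianReal 0 1).integrableOn measurableSet_Ioi fun t ht => le_of_lt ht

theorem mul_gaussianPDFReal_le (w : ℝ) :
    w * gaussianPDFReal 0 1 w ≤ (1 + w ^ 2) * (gaussianReal 0 1).real (Ioi w) := by
  have hid := integrable_id_gaussianReal 0 1
  have hint : Integrable (fun t => -1 - t * (2 * w - t)) (gaussianReal 0 1) := by
    refine ((memLp_id_gaussianReal 2).integrable_sq.sub
      ((hid.const_mul (2 * w)).add (integrable_const 1))).congr (ae_of_all _ fun t => ?_)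
    simp only [Pi.sub_apply, Pi.add_apply, id]
    ring
  have h := integral_Ioi_gaussianReal_deriv_sub_mul w
    (fun t => (hasDerivAt_id t).const_sub (2 * w)) ((integrable_const _).sub hid) hint
  have hmono : ∫ _ in Ioi w, -(1 + w ^ 2) ∂gaussianReal 0 1
      ≤ ∫ t in Ioi w, (-1 - t * (2 * w - t)) ∂gaussianReal 0 1 :=
    setIntegral_mono (integrable_const _).integrableOn hint.integrableOn
      fun t => by nlinarith only [sq_nonneg (t - w)]
  simp only [id] at h
  rw [setIntegral_const, smul_eq_mul, h] at hmono
  linarith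

end Gaussian

section SteinEquation

open MeasureTheory ProbabilityTheory Set

/-- The solution `f` of Stein's equation `f' w - w * f w = k w`, for `k` centered with respect to
the standard Gaussian. -/
def steinSol (k : ℝ → ℝ) (w : ℝ) : ℝ :=
  (∫ t in Iic w, k t ∂gaussianReal 0 1) / gaussianPDFReal 0 1 w

/-- The continuous functions that are integrable with mean zero for the standard Gaussian: the
admissible right-hand sides of Stein's equation. -/
structure GaussCentered (k : ℝ → ℝ) : Prop where
  continuous : Continuous k
  integrable : Integrable k (gaussianReal 0 1)
  integral_eq_zero : ∫ t, k t ∂gaussianReal 0 1 = 0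

namespace GaussCentered

variable {k l : ℝ → ℝ}

theorem sub (hk : GaussCentered k) (hl : GaussCentered l) : GaussCentered (k - l) where
  continuous := hk.continuous.sub hl.continuous
  integrable := hk.integrable.sub hl.integrable
  integral_eq_zero := by
    rw [integral_sub' hk.integrable hl.integrable, hk.integral_eq_zero, hl.integral_eq_zero,
      sub_zero]

theorem const_mul_id (c : ℝ) : GaussCentered fun x => c * x where
  continuous := by fun_prop
  integrable := (integrable_id_gaussianReal 0 1).const_mul c
  integral_eq_zero := by rw [integral_const_mul, integral_id_gaussianReal, mul_zero]

theorem reflect (hk : GaussCentered k) : GaussCentered fun x => -k (-x) where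
  continuous := (hk.continuous.comp continuous_neg).neg
  integrable := by
    refine (Integrable.comp_measurable (f := fun x : ℝ => -x) ?_ measurable_neg).neg
    rw [gaussianReal_map_neg, neg_zero]
    exact hk.integrable
  integral_eq_zero := by
    have h := integral_map (μ := gaussianReal 0 1) measurable_neg.aemeasurable
      hk.continuous.aestronglyMeasurable
    rw [gaussianReal_map_neg, neg_zero, hk.integral_eq_zero] at h
    rw [integral_neg, ← h, neg_zero]

theorem hasDerivAt_steinSol (hk : GaussCentered k) (w : ℝ) :
    HasDerivAt (steinSol k) (w * steinSol k w + k w) w := by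
  have hpos := gaussianPDFReal_pos 0 1 w one_ne_zero
  have hint := (integrable_gaussianReal_iff one_ne_zero).1 hk.integrable
  have hcont : Continuous fun t => gaussianPDFReal 0 1 t * k t := by
    have hpdf : Continuous (gaussianPDFReal 0 1) :=
      continuous_iff_continuousAt.2 fun t => (hasDerivAt_gaussianPDFReal_zero_one t).continuousAt
    exact hpdf.mul hk.continuous
  have hprim (w : ℝ) : ∫ t in Iic w, k t ∂gaussianReal 0 1
      = (∫ t in (0 : ℝ)..w, gaussianPDFReal 0 1 t * k t)
        + ∫ t in Iic 0, gaussianPDFReal 0 1 t * k t := by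
    rw [setIntegral_gaussianReal one_ne_zero,
      ← intervalIntegral.integral_Iic_sub_Iic hint.integrableOn hint.integrableOn,
      sub_add_cancel]
  have hderiv : HasDerivAt (fun w => ∫ t in Iic w, k t ∂gaussianReal 0 1)
      (gaussianPDFReal 0 1 w * k w) w := by
    simp only [hprim]
    exact (intervalIntegral.integral_hasDerivAt_right (hcont.intervalIntegrable _ _)
      hcont.stronglyMeasurable.stronglyMeasurableAtFilter hcont.continuousAt).add_const _
  convert! hderiv.div (hasDerivAt_gaussianPDFReal_zero_one w) hpos.ne' using 1
  rw [steinSol]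
  field_simp
  ring

theorem steinSol_eq_neg_integral_Ioi (hk : GaussCentered k) (w : ℝ) :
    steinSol k w = -((∫ t in Ioi w, k t ∂gaussianReal 0 1) / gaussianPDFReal 0 1 w) := by
  have h := intervalIntegral.integral_Iic_add_Ioi (b := w) hk.integrable.integrableOn
    hk.integrable.integrableOn
  rw [hk.integral_eq_zero] at h
  rw [steinSol, eq_neg_of_add_eq_zero_left h, neg_div]

theorem steinSol_reflect (hk : GaussCentered k) (w : ℝ) :
    steinSol (fun x => -k (-x)) w = steinSol k (-w) := by
  have hpdf : gaussianPDFReal 0 1 (-w) = gaussianPDFReal 0 1 w := by simp [gaussianPDFReal]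
  have hmap : ∫ t in Ioi (-w), k t ∂gaussianReal 0 1 = ∫ t in Iio w, k (-t) ∂gaussianReal 0 1 := by
    have h := setIntegral_map (μ := gaussianReal 0 1) (measurableSet_Ioi (a := -w))
      hk.continuous.aestronglyMeasurable measurable_neg.aemeasurable
    rw [gaussianReal_map_neg, neg_zero] at h
    simpa using h
  have := nullSingletonClass_gaussianReal (μ := 0) (one_ne_zero (α := NNReal))
  rw [hk.steinSol_eq_neg_integral_Ioi, hpdf, hmap, steinSol, integral_neg, neg_div,
    integral_Iic_eq_integral_Iio]

theorem steinSol_sub (hk : GaussCentered k) (hl : GaussCentered l) (w : ℝ) :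
    steinSol (k - l) w = steinSol k w - steinSol l w := by
  rw [steinSol, integral_sub' hk.integrable.integrableOn hl.integrable.integrableOn, sub_div]
  rfl

theorem steinSol_const_mul_id (c w : ℝ) : steinSol (fun x => c * x) w = -c := by
  rw [(const_mul_id c).steinSol_eq_neg_integral_Ioi, integral_const_mul,
    integral_Ioi_id_gaussianReal,
    mul_div_cancel_right₀ _ (gaussianPDFReal_pos 0 1 w one_ne_zero).ne']

theorem abs_mul_steinSol_le (hk : GaussCentered k) {C : ℝ} (hC : ∀ x, |k x| ≤ C) (w : ℝ) :
    |w * steinSol k w| ≤ C := by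
  wlog hw : 0 ≤ w generalizing k w
  · have h := this hk.reflect (fun x => by rw [abs_neg]; exact hC _) (-w) (by linarith)
    rwa [hk.steinSol_reflect, neg_neg, neg_mul, abs_neg] at h
  have hC0 : 0 ≤ C := (abs_nonneg _).trans (hC 0)
  have hpos := gaussianPDFReal_pos 0 1 w one_ne_zero
  have htail : |∫ t in Ioi w, k t ∂gaussianReal 0 1| ≤ C * (gaussianReal 0 1).real (Ioi w) := by
    rw [← Real.norm_eq_abs]
    exact norm_setIntegral_le_of_norm_le_const (measure_lt_top _ _) fun t _ => hC t
  rw [hk.steinSol_eq_neg_integral_Ioi, abs_mul, abs_neg, abs_div, abs_of_nonneg hw,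
    abs_of_pos hpos, ← mul_div_assoc, div_le_iff₀ hpos]
  calc w * |∫ t in Ioi w, k t ∂gaussianReal 0 1|
      ≤ w * (C * (gaussianReal 0 1).real (Ioi w)) := by gcongr
    _ = C * (w * (gaussianReal 0 1).real (Ioi w)) := by ring
    _ ≤ C * gaussianPDFReal 0 1 w := by gcongr; exact mul_gaussianReal_Ioi_le w

theorem steinSol_add_mul_nonneg (hk : GaussCentered k) (hanti : Antitone k) (w : ℝ) :
    0 ≤ (1 + w ^ 2) * steinSol k w + w * k w := by
  wlog hw : 0 ≤ w generalizing k w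
  · have h := this hk.reflect (fun x y hxy => neg_le_neg (hanti (neg_le_neg hxy))) (-w)
      (by linarith)
    rw [hk.steinSol_reflect, neg_neg, neg_sq] at h
    linarith
  have hpos := gaussianPDFReal_pos 0 1 w one_ne_zero
  rcases le_total 0 (k w) with hkw | hkw
  · have : 0 ≤ steinSol k w := div_nonneg
      (setIntegral_nonneg measurableSet_Iic fun t ht => hkw.trans (hanti ht)) hpos.le
    positivity
  · have htail : ∫ t in Ioi w, k t ∂gaussianReal 0 1 ≤ k w * (gaussianReal 0 1).real (Ioi w) := by
      rw [mul_comm, ← smul_eq_mul, ← setIntegral_const]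
      exact setIntegral_mono_on hk.integrable.integrableOn (integrable_const _).integrableOn
        measurableSet_Ioi fun t ht => hanti (le_of_lt ht)
    have hbound : (1 + w ^ 2) * (∫ t in Ioi w, k t ∂gaussianReal 0 1)
        ≤ w * k w * gaussianPDFReal 0 1 w := by
      calc (1 + w ^ 2) * (∫ t in Ioi w, k t ∂gaussianReal 0 1)
          ≤ (1 + w ^ 2) * (k w * (gaussianReal 0 1).real (Ioi w)) := by gcongr
        _ = k w * ((1 + w ^ 2) * (gaussianReal 0 1).real (Ioi w)) := by ring
        _ ≤ k w * (w * gaussianPDFReal 0 1 w) :=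
          mul_le_mul_of_nonpos_left (mul_gaussianPDFReal_le w) hkw
        _ = w * k w * gaussianPDFReal 0 1 w := by ring
    rw [hk.steinSol_eq_neg_integral_Ioi, mul_neg, ← mul_div_assoc, neg_add_eq_sub, sub_nonneg,
      div_le_iff₀ hpos]
    exact hbound

theorem monotone_mul_steinSol (hk : GaussCentered k) (hanti : Antitone k) :
    Monotone fun w => w * steinSol k w := by
  have hderiv (w : ℝ) : HasDerivAt (fun w => w * steinSol k w)
      ((1 + w ^ 2) * steinSol k w + w * k w) w := by
    convert! (hasDerivAt_id w).mul (hk.hasDerivAt_steinSol w) using 1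
    simp only [id]
    ring
  refine monotone_of_deriv_nonneg (fun w => (hderiv w).differentiableAt) fun w => ?_
  rw [(hderiv w).deriv]
  exact hk.steinSol_add_mul_nonneg hanti w

-- The lower bound on the slope of `k` enters through linearity of `steinSol`: for `k x = -c * x`
-- the solution is the constant `c`.
theorem mul_steinSol_sub_le (hk : GaussCentered k) {c : ℝ} (hc : Monotone fun x => k x + c * x)
    {w w' : ℝ} (h : w ≤ w') : w' * steinSol k w' - w * steinSol k w ≤ c * (w' - w) := by
  have hanti : Antitone ((fun x => -c * x) - k) := fun x y hxy => by
    have := hc hxy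
    simp only [Pi.sub_apply] at this ⊢
    linarith
  have hmono := ((const_mul_id (-c)).sub hk).monotone_mul_steinSol hanti h
  simp only [(const_mul_id (-c)).steinSol_sub hk, steinSol_const_mul_id] at hmono
  linarith

theorem abs_deriv_steinSol_sub_le (hk : GaussCentered k) {c : ℝ} (hanti : Antitone k)
    (hc : Monotone fun x => k x + c * x) (w w' : ℝ) :
    |(w' * steinSol k w' + k w') - (w * steinSol k w + k w)| ≤ c * |w' - w| := by
  wlog hw : w ≤ w' generalizing w w'
  · rw [abs_sub_comm, abs_sub_comm w']
    exact this w' w (le_of_not_ge hw)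
  have hupper := hk.mul_steinSol_sub_le hc hw
  have hmono := hk.monotone_mul_steinSol hanti hw
  have hkanti := hanti hw
  have hkmono := hc hw
  dsimp only at hmono hkmono
  rw [abs_of_nonneg (sub_nonneg.2 hw), abs_le]
  constructor <;> linarith

end GaussCentered

end SteinEquation

section Ramp

open MeasureTheory ProbabilityTheory Set

/-- The function which is `1` up to `s` and then decreases to `0` with slope `-L`. -/
def ramp (L s x : ℝ) : ℝ := max 0 (min 1 (1 - L * (x - s)))

variable {L : ℝ}

theorem continuous_ramp (L s : ℝ) : Continuous (ramp L s) := by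
  unfold ramp
  fun_prop

theorem ramp_mem_Icc (L s x : ℝ) : ramp L s x ∈ Icc 0 1 :=
  ⟨le_max_left _ _, max_le zero_le_one (min_le_left _ _)⟩

theorem antitone_ramp (hL : 0 ≤ L) (s : ℝ) : Antitone (ramp L s) := fun x y hxy => by
  unfold ramp
  gcongr

theorem monotone_ramp_add_mul (hL : 0 ≤ L) (s : ℝ) : Monotone fun x => ramp L s x + L * x := by
  have hrw (x : ℝ) : ramp L s x + L * x = max (L * x) (min (1 + L * x) (1 + L * s)) := by
    rw [ramp, ← max_add_add_right, ← min_add_add_right]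
    ring_nf
  intro x y hxy
  simp only [hrw]
  gcongr

theorem integrable_ramp (ν : Measure ℝ) [IsFiniteMeasure ν] (s : ℝ) : Integrable (ramp L s) ν :=
  .of_mem_Icc 0 1 (continuous_ramp L s).aemeasurable (ae_of_all _ fun x => ramp_mem_Icc L s x)

theorem integral_ramp_mem_Icc (ν : Measure ℝ) [IsProbabilityMeasure ν] (L s : ℝ) :
    ∫ x, ramp L s x ∂ν ∈ Icc 0 1 :=
  ⟨integral_nonneg fun x => (ramp_mem_Icc L s x).1,
    (integral_mono (integrable_ramp ν s) (integrable_const 1)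
      fun x => (ramp_mem_Icc L s x).2).trans_eq (by simp)⟩

theorem cdf_le_integral_ramp (ν : Measure ℝ) [IsProbabilityMeasure ν] (hL : 0 ≤ L) (s : ℝ) :
    cdf ν s ≤ ∫ x, ramp L s x ∂ν := by
  rw [cdf_eq_real, ← integral_indicator_one measurableSet_Iic]
  refine integral_mono ((integrable_const 1).indicator measurableSet_Iic) (integrable_ramp ν s) ?_
  refine indicator_le' (fun x hx => le_max_of_le_right (le_min le_rfl ?_))
    fun x _ => (ramp_mem_Icc L s x).1
  have := mul_nonpos_of_nonneg_of_nonpos hL (sub_nonpos.2 (mem_Iic.1 hx))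
  simp only [Pi.one_apply]
  linarith

theorem integral_ramp_le_cdf (ν : Measure ℝ) [IsProbabilityMeasure ν] (hL : 0 < L) (s : ℝ) :
    ∫ x, ramp L s x ∂ν ≤ cdf ν (s + 1 / L) := by
  rw [cdf_eq_real, ← integral_indicator_one measurableSet_Iic]
  refine integral_mono (integrable_ramp ν s) ((integrable_const 1).indicator measurableSet_Iic) ?_
  refine le_indicator (fun x _ => (ramp_mem_Icc L s x).2) fun x hx => ?_
  have : 1 < L * (x - s) := by
    rw [mul_comm, ← div_lt_iff₀ hL]
    linarith [notMem_Iic.1 hx]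
  exact max_le le_rfl ((min_le_right _ _).trans (by linarith))

theorem abs_cdf_sub_cdf_le {ν ν' : Measure ℝ} [IsProbabilityMeasure ν] [IsProbabilityMeasure ν']
    {B K : ℝ} (hK : ∀ x y, x ≤ y → cdf ν' y - cdf ν' x ≤ K * (y - x)) (hL : 0 < L)
    (hB : ∀ s, |∫ x, ramp L s x ∂ν - ∫ x, ramp L s x ∂ν'| ≤ B) (x : ℝ) :
    |cdf ν x - cdf ν' x| ≤ B + K / L := by
  have hupper : cdf ν x ≤ cdf ν' x + (B + K / L) := by
    have hcdf := hK x (x + 1 / L) (by simpa using hL.le)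
    have hramp := cdf_le_integral_ramp ν hL.le x
    have hramp' := integral_ramp_le_cdf ν' hL x
    have hdiff := (abs_le.1 (hB x)).2
    rw [add_sub_cancel_left, mul_one_div] at hcdf
    linarith
  have hlower : cdf ν' x ≤ cdf ν x + (B + K / L) := by
    have hcdf := hK (x - 1 / L) x (by simpa using hL.le)
    have hramp := integral_ramp_le_cdf ν hL (x - 1 / L)
    have hramp' := cdf_le_integral_ramp ν' hL.le (x - 1 / L)
    have hdiff := (abs_le.1 (hB (x - 1 / L))).1
    rw [sub_sub_cancel, mul_one_div] at hcdf
    rw [sub_add_cancel] at hramp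
    linarith
  rw [abs_le]
  constructor <;> linarith

theorem cdf_gaussianReal_sub_le {x y : ℝ} (hxy : x ≤ y) :
    cdf (gaussianReal 0 1) y - cdf (gaussianReal 0 1) x ≤ 1 / √(2 * Real.pi) * (y - x) := by
  have hdiff : cdf (gaussianReal 0 1) y - cdf (gaussianReal 0 1) x
      = ∫ t in Ioc x y, gaussianPDFReal 0 1 t := by
    have h := setIntegral_gaussianReal (μ := 0) one_ne_zero (Ioc x y) fun _ => 1
    simp only [mul_one] at h
    rw [← h, setIntegral_const, smul_eq_mul, mul_one, ← Iic_sdiff_Iic,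
      measureReal_sdiff (Iic_subset_Iic.2 hxy) measurableSet_Iic, cdf_eq_real, cdf_eq_real]
  calc _ = ∫ t in Ioc x y, gaussianPDFReal 0 1 t := hdiff
    _ ≤ ∫ _ in Ioc x y, 1 / √(2 * Real.pi) :=
      setIntegral_mono (integrable_gaussianPDFReal 0 1).integrableOn
        (integrableOn_const measure_Ioc_lt_top.ne) gaussianPDFReal_zero_one_le
    _ = 1 / √(2 * Real.pi) * (y - x) := by
      rw [setIntegral_const, Real.volume_real_Ioc_of_le hxy, smul_eq_mul, mul_comm]

theorem gaussCentered_ramp_sub_integral (L s : ℝ) :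
    GaussCentered fun x => ramp L s x - ∫ t, ramp L s t ∂gaussianReal 0 1 where
  continuous := (continuous_ramp L s).sub continuous_const
  integrable := (integrable_ramp _ s).sub (integrable_const _)
  integral_eq_zero := by
    rw [integral_sub (integrable_ramp _ s) (integrable_const _), integral_const, probReal_univ,
      one_smul, sub_self]


theorem exists_hasDerivAt_ramp_stein_eq (hL : 0 ≤ L) (s : ℝ) :
    ∃ f f' : ℝ → ℝ, (∀ w, HasDerivAt f (f' w) w) ∧
      (∀ w, f' w - w * f w = ramp L s w - ∫ t, ramp L s t ∂gaussianReal 0 1) ∧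
      (∀ w, |f' w| ≤ 2) ∧ ∀ w w', |f' w' - f' w| ≤ L * |w' - w| := by
  set k : ℝ → ℝ := fun x => ramp L s x - ∫ t, ramp L s t ∂gaussianReal 0 1 with hk_def
  have hk : GaussCentered k := gaussCentered_ramp_sub_integral L s
  have hk_le (x : ℝ) : |k x| ≤ 1 := by
    have hramp := ramp_mem_Icc L s x
    have hmean := integral_ramp_mem_Icc (gaussianReal 0 1) L s
    rw [abs_le]
    constructor <;> linarith [hramp.1, hramp.2, hmean.1, hmean.2]
  have hanti : Antitone k := fun x y hxy => sub_le_sub_right (antitone_ramp hL s hxy) _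
  have hmono : Monotone fun x => k x + L * x := fun x y hxy => by
    have := monotone_ramp_add_mul hL s hxy
    simp only [hk_def] at this ⊢
    linarith
  refine ⟨steinSol k, fun w => w * steinSol k w + k w, hk.hasDerivAt_steinSol,
    fun w => add_sub_cancel_left _ _, fun w => ?_, hk.abs_deriv_steinSol_sub_le hanti hmono⟩
  calc |w * steinSol k w + k w| ≤ |w * steinSol k w| + |k w| := abs_add_le _ _
    _ ≤ 1 + 1 := add_le_add (hk.abs_mul_steinSol_le hk_le w) (hk_le w)
    _ = 2 := one_add_one_eq_two

end Ramp

section ExchangeablePair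

open MeasureTheory ProbabilityTheory

section Moments

variable {Ω : Type*} {mΩ : MeasurableSpace Ω} {P : Measure Ω} {X Y : Ω → ℝ}

theorem integrable_pow_mul_pow [IsFiniteMeasure P] {i j n : ℕ} (hX : MemLp X n P)
    (hY : MemLp Y n P) (hij : i + j = n) : Integrable (fun x => X x ^ i * Y x ^ j) P := by
  refine (hX.integrable_norm_pow'.add hY.integrable_norm_pow').mono'
    ((hX.1.pow i).mul (hY.1.pow j)) (ae_of_all _ fun x => ?_)
  rw [norm_mul, norm_pow, norm_pow]
  calc ‖X x‖ ^ i * ‖Y x‖ ^ j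
      ≤ max ‖X x‖ ‖Y x‖ ^ i * max ‖X x‖ ‖Y x‖ ^ j := by
        gcongr
        exacts [le_max_left _ _, le_max_right _ _]
    _ = max (‖X x‖ ^ n) (‖Y x‖ ^ n) := by
        rw [← pow_add, hij]
        exact pow_left_monotoneOn.map_max (norm_nonneg _) (norm_nonneg _)
    _ ≤ ‖X x‖ ^ n + ‖Y x‖ ^ n := max_le_add_of_nonneg (by positivity) (by positivity)

theorem memLp_two_sq [IsFiniteMeasure P] (hX : MemLp X 4 P) : MemLp (fun x => X x ^ 2) 2 P := by
  refine (memLp_two_iff_integrable_sq (f := fun x => X x ^ 2) (hX.1.pow 2)).2 ?_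
  simpa only [← pow_mul, pow_zero, mul_one] using
    integrable_pow_mul_pow (i := 4) (j := 0) hX hX rfl

theorem memLp_comp_of_abs_deriv_le [IsFiniteMeasure P] {p : ENNReal} (hX : MemLp X p P)
    {f f' : ℝ → ℝ} {C : ℝ} (hf : ∀ w, HasDerivAt f (f' w) w) (hC : ∀ w, |f' w| ≤ C) :
    MemLp (fun x => f (X x)) p P := by
  have hfcont : Continuous f := continuous_iff_continuousAt.2 fun w => (hf w).continuousAt
  refine ((memLp_const |f 0|).add (hX.norm.const_mul C)).mono'
    (hfcont.comp_aestronglyMeasurable hX.1) (ae_of_all _ fun x => ?_)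
  have hmvt := convex_univ.norm_image_sub_le_of_norm_hasDerivWithin_le
    (fun w _ => (hf w).hasDerivWithinAt) (fun w _ => hC w) (Set.mem_univ 0) (Set.mem_univ (X x))
  rw [sub_zero] at hmvt
  exact (norm_le_norm_add_norm_sub' (f (X x)) (f 0)).trans (add_le_add_right hmvt _)

theorem integral_abs_mul_le_sqrt_mul_sqrt (hX : MemLp X 2 P) (hY : MemLp Y 2 P) :
    ∫ x, |X x| * |Y x| ∂P ≤ √(∫ x, X x ^ 2 ∂P) * √(∫ x, Y x ^ 2 ∂P) := by
  have h := integral_mul_norm_le_Lp_mul_Lq (f := X) (g := Y) (μ := P) Real.HolderConjugate.two_two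
    (by simpa using hX) (by simpa using hY)
  simpa only [Real.norm_eq_abs, Real.rpow_two, sq_abs, ← Real.sqrt_eq_rpow] using h

theorem integral_abs_pow_three_le_sqrt_mul_sqrt [IsFiniteMeasure P] (hX : MemLp X 4 P) :
    ∫ x, |X x| ^ 3 ∂P ≤ √(∫ x, X x ^ 2 ∂P) * √(∫ x, X x ^ 4 ∂P) := by
  have h := integral_abs_mul_le_sqrt_mul_sqrt (hX.mono_exponent (by norm_num)) (memLp_two_sq hX)
  simpa only [abs_pow, ← pow_succ', ← pow_mul] using h

theorem integral_abs_le_sqrt_integral_sq [IsProbabilityMeasure P] (hX : MemLp X 2 P) :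
    ∫ x, |X x| ∂P ≤ √(∫ x, X x ^ 2 ∂P) := by
  simpa using integral_abs_mul_le_sqrt_mul_sqrt hX (memLp_const 1)

end Moments

theorem le_two_mul_sqrt_of_forall_pos_le {b p q : ℝ} (hq : 0 < q)
    (h : ∀ L > 0, b ≤ p * L + q / L) : b ≤ 2 * √(p * q) := by
  by_contra! hlt
  have hb : 0 < b := (mul_nonneg zero_le_two (Real.sqrt_nonneg _)).trans_lt hlt
  have hpq : p * q < (b / 2) ^ 2 := (Real.sqrt_lt' (half_pos hb)).1 (by linarith)
  have hL := h (2 * q / b) (by positivity)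
  have hp : p * (2 * q / b) = p * q / (b / 2) ^ 2 * (b / 2) := by
    field_simp
  have hq' : q / (2 * q / b) = b / 2 := by
    field_simp
  have hratio : p * q / (b / 2) ^ 2 < 1 := (div_lt_one (by positivity)).2 hpq
  rw [hp, hq'] at hL
  nlinarith

theorem two_mul_sqrt_mul_eq_rpow {a M : ℝ} (ha : 0 < a) (hM : 0 ≤ M) :
    2 * √(√(2 * a) * √M / (4 * a) * (1 / √(2 * Real.pi))) = (M / (Real.pi * a)) ^ (1 / 4 : ℝ) := by
  have hsqrt : 2 ^ 2 * (√(2 * a) * √M / (4 * a) * (1 / √(2 * Real.pi)))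
      = √(M / (Real.pi * a)) := by
    rw [Real.sqrt_div hM, Real.sqrt_mul zero_le_two, Real.sqrt_mul zero_le_two,
      Real.sqrt_mul Real.pi_pos.le]
    field_simp
    rw [Real.sq_sqrt ha.le]
    ring
  calc 2 * √(√(2 * a) * √M / (4 * a) * (1 / √(2 * Real.pi)))
      = √√(M / (Real.pi * a)) := by
        rw [← hsqrt, Real.sqrt_mul (by positivity) (_ * _), Real.sqrt_sq zero_le_two]
    _ = (M / (Real.pi * a)) ^ (1 / 4 : ℝ) := by
        rw [Real.sqrt_eq_rpow, Real.sqrt_eq_rpow, ← Real.rpow_mul (by positivity)]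
        norm_num

theorem abs_sub_sub_mul_le_of_lipschitz_deriv {f f' : ℝ → ℝ} {L : ℝ}
    (hf : ∀ w, HasDerivAt f (f' w) w) (hL : ∀ w w', |f' w' - f' w| ≤ L * |w' - w|) (w w' : ℝ) :
    |f w' - f w - (w' - w) * f' w| ≤ L / 2 * (w' - w) ^ 2 := by
  have hcont : Continuous f' := (LipschitzWith.of_dist_le' fun w w' => hL w' w).continuous
  set D := w' - w with hD
  have hderiv (s : ℝ) : HasDerivAt (fun s => f (w + s * D) - s * (D * f' w))
      (D * (f' (w + s * D) - f' w)) s := by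
    have hline : HasDerivAt (fun s => w + s * D) D s := by
      simpa using ((hasDerivAt_id s).mul_const D).const_add w
    convert! ((hf (w + s * D)).comp s hline).sub ((hasDerivAt_id s).mul_const (D * f' w)) using 1
    ring
  have hremainder : ∫ s in (0 : ℝ)..1, D * (f' (w + s * D) - f' w) = f w' - f w - D * f' w := by
    rw [intervalIntegral.integral_eq_sub_of_hasDerivAt (fun s _ => hderiv s)
      (Continuous.intervalIntegrable (by fun_prop) _ _)]
    simp only [hD]
    ring_nf
  have hbound : ∫ s in (0 : ℝ)..1, L * D ^ 2 * s = L / 2 * D ^ 2 := by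
    rw [intervalIntegral.integral_const_mul, integral_id]
    ring
  rw [← hremainder, ← hbound, ← Real.norm_eq_abs]
  refine intervalIntegral.norm_integral_le_of_norm_le zero_le_one (ae_of_all _ fun s hs => ?_)
    (Continuous.intervalIntegrable (by fun_prop) _ _)
  have hLip := hL w (w + s * D)
  rw [add_sub_cancel_left, abs_mul, abs_of_pos hs.1] at hLip
  calc ‖D * (f' (w + s * D) - f' w)‖ = |D| * |f' (w + s * D) - f' w| := by
        rw [Real.norm_eq_abs, abs_mul]
    _ ≤ |D| * (L * (s * |D|)) := by gcongr
    _ = L * |D| ^ 2 * s := by ring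
    _ = L * D ^ 2 * s := by rw [sq_abs]

/-- An exchangeable pair `(X, Y)` of random variables with four moments and `E[X²] = 1`, together
with a σ-algebra `m` for which `X` is measurable and the linear regression property
`E[Y | m] = (1 - a) X` holds. -/
structure IsSteinPair {Ω : Type*} (m : MeasurableSpace Ω) {mΩ : MeasurableSpace Ω}
    (P : Measure Ω) (X Y : Ω → ℝ) (a : ℝ) : Prop where
  le : m ≤ mΩ
  stronglyMeasurable_fst : StronglyMeasurable[m] X
  memLp_fst : MemLp X 4 P
  identDistrib_swap : IdentDistrib (fun x => (X x, Y x)) (fun x => (Y x, X x)) P P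
  condExp_snd : P[Y|m] =ᵐ[P] fun x => (1 - a) * X x
  integral_sq_fst : ∫ x, X x ^ 2 ∂P = 1

namespace IsSteinPair

variable {Ω : Type*} {m mΩ : MeasurableSpace Ω} {P : Measure Ω} {X Y : Ω → ℝ}
  {a : ℝ}

theorem memLp_snd (h : IsSteinPair m P X Y a) : MemLp Y 4 P :=
  (h.identDistrib_swap.comp measurable_fst).memLp_snd h.memLp_fst

theorem memLp_sub (h : IsSteinPair m P X Y a) : MemLp (fun x => Y x - X x) 4 P :=
  h.memLp_snd.sub h.memLp_fst

variable [IsProbabilityMeasure P]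

theorem integral_mul_snd (h : IsSteinPair m P X Y a) {g : Ω → ℝ} (hg : StronglyMeasurable[m] g)
    (hgY : Integrable (fun x => g x * Y x) P) :
    ∫ x, g x * Y x ∂P = (1 - a) * ∫ x, g x * X x ∂P := by
  have hYint : Integrable Y P := h.memLp_snd.integrable (by norm_num)
  calc ∫ x, g x * Y x ∂P = ∫ x, (P[g * Y|m]) x ∂P := (integral_condExp h.le).symm
    _ = ∫ x, (1 - a) * (g x * X x) ∂P := by
      refine integral_congr_ae ?_
      filter_upwards [condExp_mul_of_stronglyMeasurable_left hg hgY hYint, h.condExp_snd]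
        with x hpull hreg
      rw [hpull, Pi.mul_apply, hreg]
      ring
    _ = (1 - a) * ∫ x, g x * X x ∂P := integral_const_mul _ _

theorem integral_sub_mul_sub (h : IsSteinPair m P X Y a) {f : ℝ → ℝ} (hf : Continuous f)
    (hfX : MemLp (fun x => f (X x)) 2 P) :
    ∫ x, (Y x - X x) * (f (Y x) - f (X x)) ∂P = 2 * a * ∫ x, f (X x) * X x ∂P := by
  have hX : MemLp X 2 P := h.memLp_fst.mono_exponent (by norm_num)
  have hY : MemLp Y 2 P := h.memLp_snd.mono_exponent (by norm_num)
  have hfY : MemLp (fun x => f (Y x)) 2 P :=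
    (h.identDistrib_swap.comp (hf.measurable.comp measurable_fst)).memLp_snd hfX
  have hswap : ∫ x, f (Y x) * X x ∂P = ∫ x, f (X x) * Y x ∂P :=
    (h.identDistrib_swap.comp (u := fun p : ℝ × ℝ => f p.2 * p.1) (by fun_prop)).integral_eq
  have hdiag : ∫ x, f (Y x) * Y x ∂P = ∫ x, f (X x) * X x ∂P :=
    (h.identDistrib_swap.comp (u := fun p : ℝ × ℝ => f p.2 * p.2) (by fun_prop)).integral_eq
  have hreg := h.integral_mul_snd (hf.comp_stronglyMeasurable h.stronglyMeasurable_fst)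
    (hfX.integrable_mul hY)
  have hYY : Integrable (fun x => f (Y x) * Y x) P := hfY.integrable_mul hY
  have hXX : Integrable (fun x => f (X x) * X x) P := hfX.integrable_mul hX
  have hYX : Integrable (fun x => f (Y x) * X x) P := hfY.integrable_mul hX
  have hXY : Integrable (fun x => f (X x) * Y x) P := hfX.integrable_mul hY
  calc ∫ x, (Y x - X x) * (f (Y x) - f (X x)) ∂P
      = ∫ x, (f (Y x) * Y x + f (X x) * X x - (f (Y x) * X x + f (X x) * Y x)) ∂P := by
        congr with x
        ring
    _ = 2 * a * ∫ x, f (X x) * X x ∂P := by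
        rw [integral_sub (hYY.fun_add hXX) (hYX.fun_add hXY), integral_add hYY hXX,
          integral_add hYX hXY, hdiag, hswap, hreg]
        ring

theorem integral_sub_sq (h : IsSteinPair m P X Y a) : ∫ x, (Y x - X x) ^ 2 ∂P = 2 * a := by
  have := h.integral_sub_mul_sub continuous_id (h.memLp_fst.mono_exponent (by norm_num))
  simpa only [id, ← sq, h.integral_sq_fst, mul_one] using this

theorem nonneg (h : IsSteinPair m P X Y a) : 0 ≤ a := by
  have : 0 ≤ ∫ x, (Y x - X x) ^ 2 ∂P := integral_nonneg fun x => sq_nonneg _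
  linarith [h.integral_sub_sq]

theorem integral_sub_pow_four (h : IsSteinPair m P X Y a) :
    ∫ x, (Y x - X x) ^ 4 ∂P
      = (8 * a - 6) * ∫ x, X x ^ 4 ∂P + 6 * ∫ x, X x ^ 2 * Y x ^ 2 ∂P := by
  have hint {i j : ℕ} (hij : i + j = 4) : Integrable (fun x => X x ^ i * Y x ^ j) P :=
    integrable_pow_mul_pow h.memLp_fst h.memLp_snd hij
  have hswap (i j : ℕ) : ∫ x, X x ^ i * Y x ^ j ∂P = ∫ x, X x ^ j * Y x ^ i ∂P := by
    have := (h.identDistrib_swap.comp (u := fun p : ℝ × ℝ => p.1 ^ i * p.2 ^ j)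
      (by fun_prop)).integral_eq
    simpa only [Function.comp_def, mul_comm] using this
  have hreg : ∫ x, X x ^ 3 * Y x ^ 1 ∂P = (1 - a) * ∫ x, X x ^ 4 * Y x ^ 0 ∂P := by
    have hX3 : StronglyMeasurable[m] fun x => X x ^ 3 := h.stronglyMeasurable_fst.pow 3
    simpa only [pow_one, pow_zero, mul_one, ← pow_succ] using
      h.integral_mul_snd hX3 (by simpa only [pow_one] using hint (i := 3) (j := 1) rfl)
  have hexpand (x : Ω) : (Y x - X x) ^ 4 = (X x ^ 0 * Y x ^ 4 + X x ^ 4 * Y x ^ 0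
      + 6 * (X x ^ 2 * Y x ^ 2)) - 4 * (X x ^ 1 * Y x ^ 3 + X x ^ 3 * Y x ^ 1) := by
    ring
  have hsum := ((hint (i := 0) (j := 4) rfl).fun_add (hint (i := 4) (j := 0) rfl))
  have hodd := ((hint (i := 1) (j := 3) rfl).fun_add (hint (i := 3) (j := 1) rfl))
  have hmid := (hint (i := 2) (j := 2) rfl).const_mul 6
  simp only [hexpand]
  rw [integral_sub (hsum.fun_add hmid) (hodd.const_mul 4), integral_add hsum hmid,
    integral_add (hint rfl) (hint rfl), integral_const_mul, integral_const_mul,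
    integral_add (hint rfl) (hint rfl), hswap 1 3, hswap 0 4, hreg]
  simp only [pow_zero, mul_one]
  ring

theorem integral_mul_sub_condExp_sq (h : IsSteinPair m P X Y a) {g : Ω → ℝ}
    (hg : StronglyMeasurable[m] g) {C : ℝ} (hC : ∀ x, |g x| ≤ C) :
    ∫ x, g x * (1 - (Y x - X x) ^ 2 / (2 * a)) ∂P
      = ∫ x, g x * (1 - (P[fun x => (Y x - X x) ^ 2|m]) x / (2 * a)) ∂P := by
  have hg' : AEStronglyMeasurable g P := (hg.mono h.le).aestronglyMeasurable
  have hsq : Integrable (fun x => (Y x - X x) ^ 2) P :=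
    (h.memLp_sub.mono_exponent (by norm_num)).integrable_sq
  have hgint : Integrable g P := .of_bound hg' C (ae_of_all _ hC)
  have hgsq : Integrable (fun x => g x * (Y x - X x) ^ 2) P :=
    hsq.bdd_mul hg' (ae_of_all _ hC)
  have hgcond : Integrable (fun x => g x * (P[fun x => (Y x - X x) ^ 2|m]) x) P :=
    integrable_condExp.bdd_mul hg' (ae_of_all _ hC)
  have hpull : ∫ x, g x * (Y x - X x) ^ 2 ∂P
      = ∫ x, g x * (P[fun x => (Y x - X x) ^ 2|m]) x ∂P := by
    rw [← integral_condExp h.le]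
    exact integral_congr_ae (condExp_mul_of_stronglyMeasurable_left hg hgsq hsq)
  simp only [mul_sub, mul_one, ← mul_div_assoc]
  rw [integral_sub hgint (hgsq.div_const _), integral_sub hgint (hgcond.div_const _),
    integral_div, integral_div, hpull]

theorem integral_sub_mul_eq (h : IsSteinPair m P X Y a) (ha : a ≠ 0) {f g : ℝ → ℝ}
    (hf : Continuous f) (hg : Continuous g) (hfX : MemLp (fun x => f (X x)) 2 P) {C : ℝ}
    (hC : ∀ w, |g w| ≤ C) :
    ∫ x, (g (X x) - X x * f (X x)) ∂P
      = ∫ x, g (X x) * (1 - (Y x - X x) ^ 2 / (2 * a)) ∂P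
        - (∫ x, (Y x - X x) * (f (Y x) - f (X x) - (Y x - X x) * g (X x)) ∂P) / (2 * a) := by
  have hX : MemLp X 2 P := h.memLp_fst.mono_exponent (by norm_num)
  have hΔ : MemLp (fun x => Y x - X x) 2 P := h.memLp_sub.mono_exponent (by norm_num)
  have hfY : MemLp (fun x => f (Y x)) 2 P :=
    (h.identDistrib_swap.comp (hf.measurable.comp measurable_fst)).memLp_snd hfX
  have hgX : AEStronglyMeasurable (fun x => g (X x)) P := hg.comp_aestronglyMeasurable hX.1
  have hgint : Integrable (fun x => g (X x)) P := .of_bound hgX C (ae_of_all _ fun x => hC _)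
  have hgsq : Integrable (fun x => g (X x) * (Y x - X x) ^ 2) P :=
    hΔ.integrable_sq.bdd_mul hgX (ae_of_all _ fun x => hC _)
  have hΔf : Integrable (fun x => (Y x - X x) * (f (Y x) - f (X x))) P :=
    hΔ.integrable_mul (hfY.sub hfX)
  have hfX_mul : Integrable (fun x => f (X x) * X x) P := hfX.integrable_mul hX
  have hexpand : ∫ x, (Y x - X x) * (f (Y x) - f (X x) - (Y x - X x) * g (X x)) ∂P
      = 2 * a * ∫ x, f (X x) * X x ∂P - ∫ x, g (X x) * (Y x - X x) ^ 2 ∂P := by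
    rw [← h.integral_sub_mul_sub hf hfX, ← integral_sub hΔf hgsq]
    congr with x
    ring
  simp only [mul_sub, mul_one, ← mul_div_assoc, mul_comm (X _) (f _)] at hexpand ⊢
  rw [hexpand, integral_sub hgint hfX_mul, integral_sub hgint (hgsq.div_const _), integral_div]
  field_simp
  ring

theorem abs_integral_deriv_sub_mul_le (h : IsSteinPair m P X Y a) (ha : a ≠ 0) {f f' : ℝ → ℝ}
    {C L : ℝ} (hf : ∀ w, HasDerivAt f (f' w) w) (hC : ∀ w, |f' w| ≤ C)
    (hL : ∀ w w', |f' w' - f' w| ≤ L * |w' - w|) :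
    |∫ x, (f' (X x) - X x * f (X x)) ∂P|
      ≤ C * ∫ x, |1 - (P[fun x => (Y x - X x) ^ 2|m]) x / (2 * a)| ∂P
        + L / (4 * a) * ∫ x, |Y x - X x| ^ 3 ∂P := by
  have hpos : 0 < a := h.nonneg.lt_of_ne' ha
  have hfcont : Continuous f := continuous_iff_continuousAt.2 fun w => (hf w).continuousAt
  have hf'cont : Continuous f' := (LipschitzWith.of_dist_le' fun w w' => hL w' w).continuous
  have hfX : MemLp (fun x => f (X x)) 2 P :=
    memLp_comp_of_abs_deriv_le (h.memLp_fst.mono_exponent (by norm_num)) hf hC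
  have hmain : |∫ x, f' (X x) * (1 - (Y x - X x) ^ 2 / (2 * a)) ∂P|
      ≤ C * ∫ x, |1 - (P[fun x => (Y x - X x) ^ 2|m]) x / (2 * a)| ∂P := by
    rw [h.integral_mul_sub_condExp_sq (hf'cont.comp_stronglyMeasurable h.stronglyMeasurable_fst)
      fun x => hC _, ← integral_const_mul, ← Real.norm_eq_abs]
    have hint : Integrable (fun x => 1 - (P[fun x => (Y x - X x) ^ 2|m]) x / (2 * a)) P :=
      (integrable_const 1).sub (integrable_condExp.div_const _)
    refine norm_integral_le_of_norm_le (hint.norm.const_mul C) (ae_of_all _ fun x => ?_)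
    rw [norm_mul]
    exact mul_le_mul_of_nonneg_right (hC _) (norm_nonneg _)
  have hrem : |∫ x, (Y x - X x) * (f (Y x) - f (X x) - (Y x - X x) * f' (X x)) ∂P|
      ≤ L / 2 * ∫ x, |Y x - X x| ^ 3 ∂P := by
    rw [← integral_const_mul, ← Real.norm_eq_abs]
    have hcube : Integrable (fun x => |Y x - X x| ^ 3) P :=
      (h.memLp_sub.mono_exponent (p := (3 : ℕ)) (by norm_num)).integrable_norm_pow'
    refine norm_integral_le_of_norm_le (hcube.const_mul _) (ae_of_all _ fun x => ?_)
    rw [Real.norm_eq_abs, abs_mul, pow_succ', mul_left_comm, sq_abs]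
    gcongr
    exact abs_sub_sub_mul_le_of_lipschitz_deriv hf hL _ _
  rw [h.integral_sub_mul_eq ha hfcont hf'cont hfX hC]
  calc _ ≤ |_| + |_| := abs_sub _ _
    _ ≤ C * ∫ x, |1 - (P[fun x => (Y x - X x) ^ 2|m]) x / (2 * a)| ∂P
        + L / 2 * (∫ x, |Y x - X x| ^ 3 ∂P) / (2 * a) := by
      rw [abs_div, abs_of_pos (show 0 < 2 * a by positivity)]
      gcongr
    _ = _ := by ring

theorem abs_integral_ramp_sub_integral_ramp_le (h : IsSteinPair m P X Y a) (ha : a ≠ 0) {L : ℝ}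
    (hL : 0 ≤ L) (s : ℝ) :
    |∫ w, ramp L s w ∂P.map X - ∫ w, ramp L s w ∂gaussianReal 0 1|
      ≤ 2 * √(∫ x, (1 - (P[fun x => (Y x - X x) ^ 2|m]) x / (2 * a)) ^ 2 ∂P)
        + L / (4 * a) * (√(2 * a) * √(∫ x, (Y x - X x) ^ 4 ∂P)) := by
  have hpos : 0 < a := h.nonneg.lt_of_ne' ha
  have hX : AEMeasurable X P := h.memLp_fst.1.aemeasurable
  have : IsProbabilityMeasure (P.map X) := Measure.isProbabilityMeasure_map hX
  have hfirst : ∫ x, |1 - (P[fun x => (Y x - X x) ^ 2|m]) x / (2 * a)| ∂P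
      ≤ √(∫ x, (1 - (P[fun x => (Y x - X x) ^ 2|m]) x / (2 * a)) ^ 2 ∂P) := by
    have hcond := (memLp_two_sq h.memLp_sub).condExp (m := m)
    refine integral_abs_le_sqrt_integral_sq ((memLp_const 1).sub ?_)
    simpa only [div_eq_inv_mul] using MemLp.const_mul (hcond one_le_two) (2 * a)⁻¹
  have hthird : ∫ x, |Y x - X x| ^ 3 ∂P ≤ √(2 * a) * √(∫ x, (Y x - X x) ^ 4 ∂P) := by
    simpa only [h.integral_sub_sq] using integral_abs_pow_three_le_sqrt_mul_sqrt h.memLp_sub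
  obtain ⟨f, f', hf, hstein, hC, hLip⟩ := exists_hasDerivAt_ramp_stein_eq hL s
  have hbound := h.abs_integral_deriv_sub_mul_le ha hf hC hLip
  have hXramp : Integrable (fun x => ramp L s (X x)) P :=
    (integrable_map_measure (continuous_ramp L s).aestronglyMeasurable hX).1 (integrable_ramp _ s)
  simp only [hstein] at hbound
  rw [integral_sub hXramp (integrable_const _), integral_const, probReal_univ, one_smul,
    ← integral_map hX (continuous_ramp L s).aestronglyMeasurable] at hbound
  exact hbound.trans (by gcongr)

theorem abs_cdf_map_sub_cdf_gaussianReal_le (h : IsSteinPair m P X Y a) (ha : a ≠ 0) (x : ℝ) :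
    |cdf (P.map X) x - cdf (gaussianReal 0 1) x|
      ≤ 2 * √(∫ x, (1 - (P[fun x => (Y x - X x) ^ 2|m]) x / (2 * a)) ^ 2 ∂P)
        + ((∫ x, (Y x - X x) ^ 4 ∂P) / (Real.pi * a)) ^ (1 / 4 : ℝ) := by
  have hpos : 0 < a := h.nonneg.lt_of_ne' ha
  have : IsProbabilityMeasure (P.map X) :=
    Measure.isProbabilityMeasure_map h.memLp_fst.1.aemeasurable
  set V := ∫ x, (1 - (P[fun x => (Y x - X x) ^ 2|m]) x / (2 * a)) ^ 2 ∂P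
  set M := ∫ x, (Y x - X x) ^ 4 ∂P
  have hM : 0 ≤ M := integral_nonneg fun x => by positivity
  have hsmooth (L : ℝ) (hL : 0 < L) :
      |cdf (P.map X) x - cdf (gaussianReal 0 1) x| - 2 * √V
        ≤ √(2 * a) * √M / (4 * a) * L + 1 / √(2 * Real.pi) / L := by
    have hcdf := abs_cdf_sub_cdf_le (fun x y => cdf_gaussianReal_sub_le) hL
      (h.abs_integral_ramp_sub_integral_ramp_le ha hL.le) x
    calc _ ≤ L / (4 * a) * (√(2 * a) * √M) + 1 / √(2 * Real.pi) / L := by linarith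
      _ = _ := by ring
  have hopt := le_two_mul_sqrt_of_forall_pos_le (by positivity) hsmooth
  rw [two_mul_sqrt_mul_eq_rpow hpos hM] at hopt
  linarith

end IsSteinPair

end ExchangeablePair

section LinearAlgebra

open Module.Basis in
theorem trace_eq_trace_restrict_add_trace_mapQ {K V : Type*} [Field K] [AddCommGroup V]
    [Module K V] [FiniteDimensional K V] (U : Submodule K V) (f : Module.End K V)
    (hf : U ≤ U.comap f) :
    LinearMap.trace K V f
      = LinearMap.trace K U (f.restrict hf) + LinearMap.trace K (V ⧸ U) (U.mapQ U f hf) := by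
  let bU := Module.Free.chooseBasis K U
  let bQ := Module.Free.chooseBasis K (V ⧸ U)
  let b := sumQuot bU bQ
  rw [LinearMap.trace_eq_matrix_trace K b, LinearMap.trace_eq_matrix_trace K bU,
    LinearMap.trace_eq_matrix_trace K bQ, Matrix.trace, Fintype.sum_sum_type]
  congr 1
  · refine Finset.sum_congr rfl fun i _ => ?_
    simp only [Matrix.diag_apply, b, LinearMap.toMatrix_apply, sumQuot_inl]
    apply sumQuot_repr_inl_of_mem
  · refine Finset.sum_congr rfl fun i _ => ?_
    simp only [Matrix.diag_apply, b, LinearMap.toMatrix_apply, sumQuot_repr_inr]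
    rw [← sumQuot_inr bU bQ i, U.mapQ_apply]
    simp

open Polynomial in
theorem roots_reverse_prod_X_sub_C {K : Type*} [Field K] {s : Multiset K} (hs : 0 ∉ s) :
    (s.map fun a => X - C a).prod.reverse.roots = s.map (·⁻¹) := by
  induction s using Multiset.induction_on with
  | empty => simp [reverse]
  | cons a s ih =>
    rw [Multiset.mem_cons, not_or] at hs
    have ha : a ≠ 0 := Ne.symm hs.1
    have linear : (X - C a).reverse = C (-a) * (X - C a⁻¹) := by
      rw [show (X - C a : K[X]) = C 1 * X ^ 1 + C (-a) by simp [sub_eq_add_neg], reverse_add_C]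
      simp [reverse, mul_sub, ← C_mul, ha, add_comm]
    have hne : (X - C a).reverse * (s.map fun a => X - C a).prod.reverse ≠ 0 := by
      simp [reverse_eq_zero, X_sub_C_ne_zero, Multiset.prod_eq_zero_iff]
    rw [Multiset.map_cons, Multiset.prod_cons, reverse_mul_of_domain, roots_mul hne, ih hs.2,
      linear, roots_C_mul _ (neg_ne_zero.2 ha), roots_X_sub_C, Multiset.map_cons,
      Multiset.singleton_add]

theorem trace_inv_eq_sum_map_inv_roots_charpoly {K n : Type*} [Field K] [IsAlgClosed K] [Fintype n]
    [DecidableEq n] {A : Matrix n n K} (hA : IsUnit A) :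
    A⁻¹.trace = (A.charpoly.roots.map (·⁻¹)).sum := by
  have hdet : A.det ≠ 0 := (A.isUnit_iff_isUnit_det.1 hA).ne_zero
  have h0 : 0 ∉ A.charpoly.roots := by
    rw [Polynomial.mem_roots A.charpoly_monic.ne_zero, Polynomial.IsRoot.def,
      ← Polynomial.coeff_zero_eq_eval_zero]
    intro h
    exact hdet (by rw [A.det_eq_sign_charpoly_coeff, h, mul_zero])
  have hroots : A⁻¹.charpoly.roots = A.charpoly.reverse.roots := by
    rw [Matrix.charpoly_inv A hA, ← Matrix.reverse_charpoly, ← Polynomial.C_1, ← Polynomial.C_neg,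
      ← Polynomial.C_pow, ← Polynomial.C_mul, Polynomial.roots_C_mul]
    simpa using hdet
  rw [Matrix.trace_eq_sum_roots_charpoly, hroots, ← roots_reverse_prod_X_sub_C h0,
    ← (IsAlgClosed.splits A.charpoly).eq_prod_roots_of_monic A.charpoly_monic]

end LinearAlgebra

section WeakIntegral

open MeasureTheory

theorem integrable_of_continuous_of_compactSpace {X E : Type*} [TopologicalSpace X] [CompactSpace X]
    [MeasurableSpace X] [OpensMeasurableSpace X] [NormedAddCommGroup E]
    {μ : Measure X} [IsFiniteMeasure μ] {f : X → E} (hf : Continuous f) : Integrable f μ :=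
  hf.integrable_of_hasCompactSupport (HasCompactSupport.of_compactSpace f)

theorem exists_dual_apply_eq_integral {𝕜 E X : Type*} [RCLike 𝕜] [AddCommGroup E] [Module 𝕜 E]
    [FiniteDimensional 𝕜 E] [MeasurableSpace X] {μ : Measure X} {T : X → E}
    (hT : ∀ ℓ : Module.Dual 𝕜 E, Integrable (fun x => ℓ (T x)) μ) :
    ∃ P : E, ∀ ℓ : Module.Dual 𝕜 E, ℓ P = ∫ x, ℓ (T x) ∂μ := by
  let B : Module.Dual 𝕜 (Module.Dual 𝕜 E) :=
    { toFun := fun ℓ => ∫ x, ℓ (T x) ∂μ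
      map_add' := fun ℓ ℓ' => integral_add (hT ℓ) (hT ℓ')
      map_smul' := fun c ℓ => integral_const_mul c _ }
  exact ⟨(Module.evalEquiv 𝕜 E).symm B,
    fun ℓ => LinearMap.congr_fun ((Module.evalEquiv 𝕜 E).apply_symm_apply B) ℓ⟩

theorem continuous_dual_apply_of_basis {R E X ι : Type*} [CommSemiring R] [TopologicalSpace R]
    [IsTopologicalSemiring R] [AddCommMonoid E] [Module R E] [TopologicalSpace X] [Finite ι]
    {T : X → E} (b : Module.Basis ι R E) (hT : ∀ i, Continuous fun x => b.repr (T x) i)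
    (ℓ : Module.Dual R E) : Continuous fun x => ℓ (T x) := by
  have := Fintype.ofFinite ι
  have expansion (x : X) : ℓ (T x) = ∑ i, b.repr (T x) i * ℓ (b i) := by
    conv_lhs => rw [← b.sum_repr (T x)]
    simp only [map_sum, map_smul, smul_eq_mul]
  simp only [expansion]
  fun_prop

end WeakIntegral

section ConjSpace

open Representation

variable {V ι : Type*} [AddCommGroup V] [Module ℂ V]

/-- A basis of `V`, regarded as a basis of the conjugate space; the coordinates of a vector get
conjugated. -/
def ConjSpace.basis (b : Module.Basis ι ℂ V) : Module.Basis ι ℂ (ConjSpace V) :=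
  @Module.Basis.mapCoeffs ι ℂ V _ _ _ b ℂ _ (ConjSpace.instModule V) starRingAut
    fun c v => congrArg (· • v) (Complex.conj_conj c)

theorem ConjSpace.basis_apply (b : Module.Basis ι ℂ V) (i : ι) : ConjSpace.basis b i = b i :=
  @Module.Basis.mapCoeffs_apply ι ℂ V _ _ _ b ℂ _ (ConjSpace.instModule V) starRingAut _ i

theorem ConjSpace.basis_repr_apply (b : Module.Basis ι ℂ V) (v : ConjSpace V) (i : ι) :
    (ConjSpace.basis b).repr v i = conj (b.repr v i) :=
  rfl

instance ConjSpace.instFiniteDimensional [FiniteDimensional ℂ V] :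
    FiniteDimensional ℂ (ConjSpace V) :=
  (ConjSpace.basis (Module.finBasis ℂ V)).finiteDimensional_of_finite

theorem ConjSpace.finrank_eq [FiniteDimensional ℂ V] :
    Module.finrank ℂ (ConjSpace V) = Module.finrank ℂ V := by
  rw [Module.finrank_eq_card_basis (ConjSpace.basis (Module.finBasis ℂ V)), Fintype.card_fin]

end ConjSpace

section Character

open Representation

theorem character_eq_sum_repr {k G V ι : Type*} [Field k] [Monoid G] [AddCommGroup V] [Module k V]
    [Fintype ι] (ρ : Representation k G V) (b : Module.Basis ι k V) (g : G) :
    ρ.character g = ∑ i, b.repr (ρ g (b i)) i := by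
  classical
  rw [character, LinearMap.trace_eq_matrix_trace k b]
  simp only [Matrix.trace, Matrix.diag_apply, LinearMap.toMatrix_apply]

theorem character_conjRep {G V : Type*} [Monoid G] [AddCommGroup V] [Module ℂ V]
    [FiniteDimensional ℂ V] (ρ : Representation ℂ G V) (g : G) :
    ρ.conjRep.character g = conj (ρ.character g) := by
  let b := Module.finBasis ℂ V
  simp only [character_eq_sum_repr _ b, character_eq_sum_repr _ (ConjSpace.basis b), map_sum,
    ConjSpace.basis_repr_apply, ConjSpace.basis_apply]
  rfl

end Character

section Irreducible

open Representation

variable {k G V W : Type*} [Field k] [Monoid G] [AddCommGroup V] [Module k V]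
  [AddCommGroup W] [Module k W] {ρ : Representation k G V} {σ : Representation k G W}

theorem isIrreducible_iff_forall_submodule :
    ρ.IsIrreducible ↔ Nontrivial V ∧
      ∀ U : Submodule k V, (∀ g, U ≤ U.comap (ρ g)) → U = ⊥ ∨ U = ⊤ := by
  rw [irreducible_iff_isSimpleModule_asModule, isSimpleModule_iff,
    ← ρ.mapSubmodule.isSimpleOrder_iff, isSimpleOrder_iff, invtSubmodule.nontrivial_iff]
  simp only [Subtype.forall, mem_invtSubmodule, Module.End.mem_invtSubmodule, Subtype.ext_iff,
    invtSubmodule.coe_bot, invtSubmodule.coe_top]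

theorem isIrreducible_of_equiv (e : ρ.Equiv σ) (h : ρ.IsIrreducible) : σ.IsIrreducible := by
  rw [irreducible_iff_isSimpleModule_asModule] at h ⊢
  exact IsSimpleModule.congr (LinearEquiv.ofBijective
    (IntertwiningMap.equivLinearMapAsModule σ ρ e.symm.toIntertwiningMap)
    e.symm.toLinearEquiv.bijective)

end Irreducible

section ContinuousCoeff

open Representation

/-- All matrix coefficients `g ↦ f (ρ g v)` of the representation `ρ` are continuous. For a
finite-dimensional `ρ` this is continuity of the representation, stated without a topology on the
space `ρ` acts on. -/
def HasContinuousCoeff {G V : Type*} [Monoid G] [TopologicalSpace G] [AddCommGroup V] [Module ℂ V]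
    (ρ : Representation ℂ G V) : Prop :=
  ∀ (f : Module.Dual ℂ V) (v : V), Continuous fun g => f (ρ g v)

namespace HasContinuousCoeff

variable {G V W : Type*} [TopologicalSpace G] [AddCommGroup V] [Module ℂ V]
  [AddCommGroup W] [Module ℂ W]

section Monoid

variable [Monoid G] {ρ : Representation ℂ G V} {σ : Representation ℂ G W}

theorem of_isContinuousAction [FiniteDimensional ℂ V] [TopologicalSpace V]
    [IsTopologicalAddGroup V] [ContinuousSMul ℂ V] [T2Space V] (h : ρ.IsContinuousAction) :
    HasContinuousCoeff ρ := fun f v => by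
  have action : Continuous fun p : G × V => ρ p.1 p.2 := h
  exact f.continuous_of_finiteDimensional.comp
    (action.comp (continuous_id.prodMk continuous_const))

theorem continuous_dual_apply [FiniteDimensional ℂ V] (hρ : HasContinuousCoeff ρ)
    (ℓ : Module.Dual ℂ (Module.End ℂ V)) : Continuous fun g => ℓ (ρ g) := by
  let b := Module.finBasis ℂ V
  refine continuous_dual_apply_of_basis b.end (fun ij => ?_) ℓ
  refine (hρ (b.coord ij.1) (b ij.2)).congr fun g => ?_
  simp [Module.Basis.end, Module.Basis.linearMap, LinearMap.toMatrix_apply, Matrix.stdBasis]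

theorem of_basis {ι : Type*} [Finite ι] (b : Module.Basis ι ℂ V)
    (h : ∀ i j, Continuous fun g => b.repr (ρ g (b j)) i) : HasContinuousCoeff ρ := fun f v => by
  have := Fintype.ofFinite ι
  refine continuous_dual_apply_of_basis b (fun i => ?_) f
  have expansion (g : G) : b.repr (ρ g v) i = ∑ j, b.repr v j * b.repr (ρ g (b j)) i := by
    conv_lhs => rw [← b.sum_repr v]
    simp only [map_sum, map_smul, Finsupp.coe_finsetSum, Finset.sum_apply, Finsupp.smul_apply,
      smul_eq_mul]
  simp only [expansion]
  exact continuous_finsetSum _ fun j _ => continuous_const.mul (h i j)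

theorem isContinuousAction_pi {n : ℕ} {ρ : Representation ℂ G (Fin n → ℂ)}
    (hρ : HasContinuousCoeff ρ) : ρ.IsContinuousAction := by
  refine continuous_pi fun i => ?_
  have expansion (p : G × (Fin n → ℂ)) : ρ p.1 p.2 i
      = ∑ j, p.2 j * LinearMap.proj (R := ℂ) (φ := fun _ : Fin n => ℂ) i
        (ρ p.1 (Pi.single j 1)) := by
    conv_lhs => rw [← (Pi.basisFun ℂ (Fin n)).sum_repr p.2]
    simp
  simp only [expansion]
  refine continuous_finsetSum _ fun j _ => Continuous.mul (by fun_prop) ?_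
  exact (hρ (LinearMap.proj i) (Pi.single j 1)).comp continuous_fst

theorem of_equiv (e : ρ.Equiv σ) (hρ : HasContinuousCoeff ρ) : HasContinuousCoeff σ := fun f v => by
  refine (hρ (f ∘ₗ e.toLinearMap) (e.symm v)).congr fun g => congrArg f ?_
  exact (IntertwiningMap.isIntertwining _ _ e.toIntertwiningMap g (e.symm v)).trans
    (congrArg (σ g) (e.apply_symm_apply v))

theorem prod (hρ : HasContinuousCoeff ρ) (hσ : HasContinuousCoeff σ) :
    HasContinuousCoeff (ρ.prod σ) := fun f v => by
  refine ((hρ (f ∘ₗ LinearMap.inl ℂ V W) v.1).add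
    (hσ (f ∘ₗ LinearMap.inr ℂ V W) v.2)).congr fun g => ?_
  rw [Pi.add_apply, LinearMap.comp_apply, LinearMap.comp_apply, ← map_add]
  exact congrArg f (by simp)

theorem tprod [FiniteDimensional ℂ V] [FiniteDimensional ℂ W]
    (hρ : HasContinuousCoeff ρ) (hσ : HasContinuousCoeff σ) : HasContinuousCoeff (ρ.tprod σ) := by
  let b := Module.finBasis ℂ V
  let c := Module.finBasis ℂ W
  refine of_basis (b.tensorProduct c) fun i j => ?_
  refine ((hρ (b.coord i.1) (b j.1)).mul (hσ (c.coord i.2) (c j.2))).congr fun g => ?_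
  rw [Module.Basis.tensorProduct_apply', Representation.tprod_apply, TensorProduct.map_tmul,
    Module.Basis.tensorProduct_repr_tmul_apply, smul_eq_mul, mul_comm]
  rfl

theorem subrepresentation (hρ : HasContinuousCoeff ρ) (U : Submodule ℂ V)
    (hU : ∀ g, U ≤ U.comap (ρ g)) : HasContinuousCoeff (ρ.subrepresentation U hU) := fun f v => by
  obtain ⟨f', rfl⟩ := LinearMap.exists_extend f
  exact hρ f' v

theorem quotient (hρ : HasContinuousCoeff ρ) (U : Submodule ℂ V)
    (hU : ∀ g, U ≤ U.comap (ρ g)) : HasContinuousCoeff (ρ.quotient U hU) := fun f v => by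
  obtain ⟨v, rfl⟩ := U.mkQ_surjective v
  exact hρ (f ∘ₗ U.mkQ) v

theorem conjRep [FiniteDimensional ℂ V] (hρ : HasContinuousCoeff ρ) :
    HasContinuousCoeff ρ.conjRep := by
  let b := Module.finBasis ℂ V
  refine of_basis (ConjSpace.basis b) fun i j => ?_
  simp only [ConjSpace.basis_repr_apply, ConjSpace.basis_apply]
  exact Complex.continuous_conj.comp (hρ (b.coord i) (b j))

theorem continuous_character [FiniteDimensional ℂ V] (hρ : HasContinuousCoeff ρ) :
    Continuous ρ.character :=
  hρ.continuous_dual_apply (LinearMap.trace ℂ V)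

end Monoid

section Group

variable [Group G] {ρ : Representation ℂ G V} {σ : Representation ℂ G W}

theorem dual [ContinuousInv G] [FiniteDimensional ℂ V] (hρ : HasContinuousCoeff ρ) :
    HasContinuousCoeff ρ.dual := fun f φ => by
  obtain ⟨v, rfl⟩ := (Module.evalEquiv ℂ V).surjective f
  exact (hρ φ v).comp continuous_inv

theorem linHom [ContinuousInv G] [FiniteDimensional ℂ V] [FiniteDimensional ℂ W]
    (hρ : HasContinuousCoeff ρ) (hσ : HasContinuousCoeff σ) : HasContinuousCoeff (ρ.linHom σ) :=
  (hρ.dual.tprod hσ).of_equiv (Equiv.dualTensorHom ρ σ)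

variable [CompactSpace G]

theorem norm_le_one_of_hasEigenvalue (hρ : HasContinuousCoeff ρ) {g : G} {z : ℂ}
    (hz : Module.End.HasEigenvalue (ρ g) z) : ‖z‖ ≤ 1 := by
  obtain ⟨v, hv⟩ := hz.exists_hasEigenvector
  obtain ⟨f, hf⟩ := Module.Projective.exists_dual_ne_zero ℂ hv.2
  obtain ⟨C, hC⟩ := (isCompact_range (hρ f v)).isBounded.exists_norm_le
  by_contra! hgt
  obtain ⟨n, hn⟩ := pow_unbounded_of_one_lt (C / ‖f v‖) hgt
  have bounded : ‖z ^ n * f v‖ ≤ C := by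
    have : ‖f (ρ (g ^ n) v)‖ ≤ C := hC _ ⟨g ^ n, rfl⟩
    rwa [map_pow, hv.pow_apply, map_smul, smul_eq_mul] at this
  rw [norm_mul, norm_pow, ← le_div_iff₀ (norm_pos_iff.2 hf)] at bounded
  exact absurd bounded (not_le.2 hn)

theorem norm_eq_one_of_hasEigenvalue (hρ : HasContinuousCoeff ρ) {g : G} {z : ℂ}
    (hz : Module.End.HasEigenvalue (ρ g) z) : ‖z‖ = 1 := by
  obtain ⟨v, hv⟩ := hz.exists_hasEigenvector
  have hv' : v = z • ρ g⁻¹ v := by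
    rw [← map_smul, ← hv.apply_eq_smul]
    simp [← Module.End.mul_apply, ← map_mul]
  have hz0 : z ≠ 0 := by
    rintro rfl
    exact hv.2 (by rw [hv', zero_smul])
  have hinv : Module.End.HasEigenvector (ρ g⁻¹) z⁻¹ v := by
    refine ⟨Module.End.mem_eigenspace_iff.2 ?_, hv.2⟩
    rw [eq_inv_smul_iff₀ hz0, ← hv']
  have hge := hρ.norm_le_one_of_hasEigenvalue (Module.End.hasEigenvalue_of_hasEigenvector hinv)
  rw [norm_inv] at hge
  exact le_antisymm (hρ.norm_le_one_of_hasEigenvalue hz)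
    ((inv_le_one₀ (norm_pos_iff.2 hz0)).1 hge)

theorem character_inv [FiniteDimensional ℂ V] (hρ : HasContinuousCoeff ρ) (g : G) :
    ρ.character g⁻¹ = conj (ρ.character g) := by
  let b := Module.finBasis ℂ V
  let A := LinearMap.toMatrix b b (ρ g)
  have hmul : A * LinearMap.toMatrix b b (ρ g⁻¹) = 1 := by
    rw [← LinearMap.toMatrix_mul, ← map_mul, mul_inv_cancel, map_one, LinearMap.toMatrix_one]
  have hroot (z : ℂ) (hz : z ∈ A.charpoly.roots) : z⁻¹ = conj z := by
    refine Complex.inv_eq_conj (hρ.norm_eq_one_of_hasEigenvalue (g := g) ?_)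
    rw [Module.End.hasEigenvalue_iff_isRoot_charpoly, ← LinearMap.charpoly_toMatrix _ b]
    exact Polynomial.isRoot_of_mem_roots hz
  rw [character, character, LinearMap.trace_eq_matrix_trace ℂ b,
    LinearMap.trace_eq_matrix_trace ℂ b, ← Matrix.inv_eq_right_inv hmul,
    trace_inv_eq_sum_map_inv_roots_charpoly (.of_mul_eq_one _ hmul),
    Multiset.map_congr rfl hroot, Matrix.trace_eq_sum_roots_charpoly, map_multiset_sum]

end Group

end HasContinuousCoeff

end ContinuousCoeff

section Orthogonality

open Representation MeasureTheory

namespace HasContinuousCoeff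

variable {G V W : Type*} [Group G] [TopologicalSpace G] [IsTopologicalGroup G] [CompactSpace G]
  [MeasurableSpace G] [BorelSpace G] (μ : Measure G) [μ.IsMulLeftInvariant]
  [AddCommGroup V] [Module ℂ V] [FiniteDimensional ℂ V]
  [AddCommGroup W] [Module ℂ W] [FiniteDimensional ℂ W]
  {ρ : Representation ℂ G V} {σ : Representation ℂ G W}

section Probability

variable [IsProbabilityMeasure μ]

theorem integral_character_eq_finrank_invariants (hρ : HasContinuousCoeff ρ) :
    ∫ g, ρ.character g ∂μ = Module.finrank ℂ ρ.invariants := by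
  obtain ⟨P, hP⟩ := exists_dual_apply_eq_integral (μ := μ) fun ℓ =>
    integrable_of_continuous_of_compactSpace (hρ.continuous_dual_apply ℓ)
  have hPv (f : Module.Dual ℂ V) (v : V) : f (P v) = ∫ g, f (ρ g v) ∂μ :=
    hP (f ∘ₗ LinearMap.applyₗ v)
  have hproj : LinearMap.IsProj ρ.invariants P := by
    refine ⟨fun v h => ?_, fun v hv => ?_⟩
    · refine Module.eval_apply_injective ℂ <| LinearMap.ext fun f => ?_
      calc f (ρ h (P v)) = ∫ g, f (ρ (h * g) v) ∂μ := by
            simpa only [map_mul, LinearMap.comp_apply, Module.End.mul_apply]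
              using hPv (f ∘ₗ ρ h) v
        _ = f (P v) := by rw [integral_mul_left_eq_self (fun g => f (ρ g v)) h, hPv]
    · refine Module.eval_apply_injective ℂ <| LinearMap.ext fun f => ?_
      rw [Module.Dual.eval_apply, hPv]
      simp only [(mem_invariants ρ v).1 hv, integral_const, probReal_univ, one_smul,
        Module.Dual.eval_apply]
  exact (hP (LinearMap.trace ℂ V)).symm.trans hproj.trace

theorem integral_character_inv_mul_character (hρ : HasContinuousCoeff ρ)
    (hσ : HasContinuousCoeff σ) :
    ∫ g, ρ.character g⁻¹ * σ.character g ∂μ = Module.finrank ℂ (IntertwiningMap ρ σ) := by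
  simp only [← char_linHom]
  rw [(hρ.linHom hσ).integral_character_eq_finrank_invariants μ,
    (invariantsEquivIntertwiningMap ρ σ).finrank_eq]

theorem integral_conj_character_mul_character (hρ : HasContinuousCoeff ρ)
    (hσ : HasContinuousCoeff σ) :
    ∫ g, conj (ρ.character g) * σ.character g ∂μ = Module.finrank ℂ (IntertwiningMap ρ σ) := by
  simp only [← hρ.character_inv]
  exact hρ.integral_character_inv_mul_character μ hσ

theorem integral_conj_character_mul_self (hρ : HasContinuousCoeff ρ) (hirr : ρ.IsIrreducible) :
    ∫ g, conj (ρ.character g) * ρ.character g ∂μ = 1 := by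
  rw [hρ.integral_conj_character_mul_character μ hρ, IsIrreducible.finrank_intertwiningMap_self,
    Nat.cast_one]

theorem integral_character_sq_eq_zero (hρ : HasContinuousCoeff ρ) (hirr : ρ.IsIrreducible)
    (hnonreal : ∃ g, (ρ.character g).im ≠ 0) : ∫ g, ρ.character g ^ 2 ∂μ = 0 := by
  have intertwining_eq_zero (f : IntertwiningMap ρ.conjRep ρ) : f = 0 := by
    refine (IsIrreducible.surjective_or_eq_zero f).resolve_left fun hsurj => ?_
    have hinj := (LinearMap.injective_iff_surjective_of_finrank_eq_finrank
      (f := f.toLinearMap) ConjSpace.finrank_eq).2 hsurj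
    obtain ⟨g, hg⟩ := hnonreal
    have hchar := congrFun (char_iso (f.ofBijective ⟨hinj, hsurj⟩)) g
    rw [character_conjRep] at hchar
    exact hg (Complex.conj_eq_iff_im.1 hchar)
  have : Subsingleton (IntertwiningMap ρ.conjRep ρ) :=
    ⟨fun f f' => (intertwining_eq_zero f).trans (intertwining_eq_zero f').symm⟩
  calc ∫ g, ρ.character g ^ 2 ∂μ = ∫ g, conj (ρ.conjRep.character g) * ρ.character g ∂μ := by
        simp only [character_conjRep, Complex.conj_conj, sq]
    _ = 0 := by
        rw [hρ.conjRep.integral_conj_character_mul_character μ hρ,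
          Module.finrank_zero_of_subsingleton, Nat.cast_zero]

end Probability

theorem exists_intertwiningMap_apply_eq_integral_conj [IsFiniteMeasure μ]
    (hρ : HasContinuousCoeff ρ) (α : G) :
    ∃ Q : IntertwiningMap ρ ρ, ∀ ℓ : Module.Dual ℂ (Module.End ℂ V),
      ℓ Q.toLinearMap = ∫ h, ℓ (ρ (h * α * h⁻¹)) ∂μ := by
  obtain ⟨Q, hQ⟩ := exists_dual_apply_eq_integral (μ := μ) (T := fun h => ρ (h * α * h⁻¹)) fun ℓ =>
    integrable_of_continuous_of_compactSpace <|
      (hρ.continuous_dual_apply ℓ).comp (f := fun h => h * α * h⁻¹) (by fun_prop)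
  refine ⟨⟨Q, fun g => LinearMap.ext fun v => ?_⟩, hQ⟩
  refine Module.eval_apply_injective ℂ <| LinearMap.ext fun f => ?_
  calc f (Q (ρ g v)) = ∫ h, f (ρ (h * α * h⁻¹) (ρ g v)) ∂μ := hQ (f ∘ₗ LinearMap.applyₗ (ρ g v))
    _ = ∫ h, f (ρ (g * h * α * (g * h)⁻¹) (ρ g v)) ∂μ :=
        (integral_mul_left_eq_self (fun h => f (ρ (h * α * h⁻¹) (ρ g v))) g).symm
    _ = ∫ h, f (ρ g (ρ (h * α * h⁻¹) v)) ∂μ := by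
        simp only [← Module.End.mul_apply, ← map_mul, mul_inv_rev, mul_assoc, inv_mul_cancel,
          mul_one]
    _ = f (ρ g (Q v)) := (hQ (f ∘ₗ ρ g ∘ₗ LinearMap.applyₗ v)).symm

theorem integral_character_mul_conj_apply [IsProbabilityMeasure μ] (hρ : HasContinuousCoeff ρ)
    (hirr : ρ.IsIrreducible) (g α : G) :
    ∫ h, ρ.character (g * (h * α * h⁻¹)) ∂μ
      = ρ.character g * (ρ.character α / (Module.finrank ℂ V : ℂ)) := by
  have := (isIrreducible_iff_forall_submodule.1 hirr).1
  have hdim : (Module.finrank ℂ V : ℂ) ≠ 0 := by exact_mod_cast Module.finrank_pos.ne'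
  obtain ⟨Q, hQ⟩ := hρ.exists_intertwiningMap_apply_eq_integral_conj μ α
  obtain ⟨c, hc⟩ := (IsIrreducible.algebraMap_intertwiningMap_bijective_of_isAlgClosed).2 Q
  have hQc : Q.toLinearMap = c • (1 : Module.End ℂ V) :=
    (congrArg IntertwiningMap.toLinearMap hc).symm
  have scalar_eq : c * Module.finrank ℂ V = ρ.character α := by
    have htrace := hQ (LinearMap.trace ℂ V)
    have hconj (h : G) : LinearMap.trace ℂ V (ρ (h * α * h⁻¹)) = ρ.character α := char_conj ρ α h
    simpa only [hQc, map_smul, LinearMap.trace_one, smul_eq_mul, hconj, integral_const,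
      probReal_univ, one_smul] using htrace
  calc ∫ h, ρ.character (g * (h * α * h⁻¹)) ∂μ
      = ∫ h, LinearMap.trace ℂ V (ρ g * ρ (h * α * h⁻¹)) ∂μ := by simp only [← map_mul]; rfl
    _ = LinearMap.trace ℂ V (ρ g * Q.toLinearMap) :=
        (hQ (LinearMap.trace ℂ V ∘ₗ LinearMap.mulLeft ℂ (ρ g))).symm
    _ = ρ.character g * c := by
        rw [hQc, mul_smul_comm, mul_one, map_smul, smul_eq_mul, mul_comm]
        rfl
    _ = ρ.character g * (ρ.character α / Module.finrank ℂ V) := by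
        rw [← scalar_eq, mul_div_cancel_right₀ _ hdim]

end HasContinuousCoeff

end Orthogonality

section CharSum

open MeasureTheory

theorem IrrepModel.hasContinuousCoeff {G : Type*} [Group G] [TopologicalSpace G]
    (σ : IrrepModel G) : HasContinuousCoeff σ.rep :=
  .of_isContinuousAction σ.continuous_rep

namespace Irr

variable {G : Type*} [Group G] [TopologicalSpace G]

theorem continuous_char (φ : Irr G) : Continuous φ.char := by
  induction φ using Quotient.ind with
  | _ σ => exact σ.hasContinuousCoeff.continuous_character

theorem exists_isTriv : ∃ φ : Irr G, φ.IsTriv := by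
  have hirr : (Representation.trivial ℂ G (Fin 1 → ℂ)).IsIrreducible := by
    have : IsSimpleOrder (Submodule ℂ (Fin 1 → ℂ)) := by
      rw [← isSimpleModule_iff, isSimpleModule_iff_finrank_eq_one, Module.finrank_fin_fun]
    exact isIrreducible_iff_forall_submodule.2 ⟨inferInstance, fun U _ => eq_bot_or_eq_top U⟩
  exact ⟨⟦⟨1, Representation.trivial ℂ G (Fin 1 → ℂ), continuous_snd, hirr⟩⟧, fun _ _ => rfl⟩

theorem IsTriv.dim_eq_one {φ : Irr G} (h : φ.IsTriv) : φ.dim = 1 := by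
  induction φ using Quotient.ind with
  | _ σ =>
    obtain ⟨hnt, hsub⟩ := isIrreducible_iff_forall_submodule.1 σ.irreducible_rep
    obtain ⟨v, hv⟩ := exists_ne (0 : Fin σ.n → ℂ)
    have line_invariant (g : G) : ℂ ∙ v ≤ (ℂ ∙ v).comap (σ.rep g) := fun w hw => by
      rwa [Submodule.mem_comap, show σ.rep g w = w from h g w]
    have line_eq_top : ℂ ∙ v = ⊤ :=
      (hsub _ line_invariant).resolve_left (Submodule.span_singleton_eq_bot.not.2 hv)
    exact (finrank_top ℂ _).symm.trans (line_eq_top ▸ finrank_span_singleton hv)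

theorem IsTriv.char_eq_one {φ : Irr G} (h : φ.IsTriv) (g : G) : φ.char g = 1 := by
  have hdim := h.dim_eq_one
  induction φ using Quotient.ind with
  | _ σ =>
    have hone : σ.rep g = 1 := LinearMap.ext (h g)
    calc LinearMap.trace ℂ _ (σ.rep g) = Module.finrank ℂ (Fin σ.n → ℂ) := by
          rw [hone, LinearMap.trace_one]
      _ = 1 := by exact_mod_cast hdim

theorem IsTriv.charRatio_eq_one {φ : Irr G} (h : φ.IsTriv) (g : G) : φ.charRatio g = 1 := by
  rw [charRatio, h.char_eq_one, h.dim_eq_one, Nat.cast_one, div_one]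

/-- The real linear combination of irreducible characters with coefficients `c`. -/
def charSum : (Irr G →₀ ℝ) →ₗ[ℝ] (G → ℂ) :=
  Finsupp.linearCombination ℝ char

theorem charSum_apply (c : Irr G →₀ ℝ) (g : G) :
    charSum c g = c.sum fun φ x => (x : ℂ) * φ.char g := by
  simp only [charSum, Finsupp.linearCombination_apply, Finsupp.sum, Finset.sum_apply,
    Pi.smul_apply, Complex.real_smul]

theorem charSum_single (φ : Irr G) (x : ℝ) (g : G) :
    charSum (Finsupp.single φ x) g = x * φ.char g := by
  rw [charSum_apply, Finsupp.sum_single_index (by simp)]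

end Irr

namespace HasContinuousCoeff

variable {G W : Type*} [Group G] [TopologicalSpace G] [AddCommGroup W] [Module ℂ W]
  [FiniteDimensional ℂ W] {ρ : Representation ℂ G W}

theorem exists_equiv_irrepModel (hρ : HasContinuousCoeff ρ) (hirr : ρ.IsIrreducible) :
    ∃ σ : IrrepModel G, Nonempty (ρ.Equiv σ.rep) := by
  let e := (Module.finBasis ℂ W).equivFun
  let r : Representation ℂ G (Fin (Module.finrank ℂ W) → ℂ) :=
    (e.conjAlgEquiv ℂ : _ →* _).comp ρ
  let E : ρ.Equiv r := Representation.Equiv.mk e fun g => by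
    ext v
    simp [r]
  exact ⟨⟨_, r, (hρ.of_equiv E).isContinuousAction_pi, isIrreducible_of_equiv E hirr⟩, ⟨E⟩⟩

theorem exists_charSum_eq_character (hρ : HasContinuousCoeff ρ) :
    ∃ c : Irr G →₀ ℝ, Irr.charSum c = ρ.character := by
  induction hn : Module.finrank ℂ W using Nat.strong_induction_on generalizing W with
  | _ n ih =>
    by_cases hirr : ρ.IsIrreducible
    · obtain ⟨σ, ⟨e⟩⟩ := hρ.exists_equiv_irrepModel hirr
      let φ : Irr G := Quotient.mk _ σ
      refine ⟨Finsupp.single φ 1, funext fun g => ?_⟩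
      rw [Irr.charSum_single, Representation.char_iso e, Complex.ofReal_one, one_mul]
      rfl
    rw [isIrreducible_iff_forall_submodule, not_and_or] at hirr
    rcases hirr with hW | hU
    · rw [not_nontrivial_iff_subsingleton] at hW
      refine ⟨0, funext fun g => ?_⟩
      rw [map_zero, Pi.zero_apply, Representation.character, Subsingleton.elim (ρ g) 0, map_zero]
    push Not at hU
    obtain ⟨U, hU, hbot, htop⟩ := hU
    have finrank_sub_lt : Module.finrank ℂ U < n := hn ▸ Submodule.finrank_lt htop
    have finrank_quotient_lt : Module.finrank ℂ (W ⧸ U) < n := by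
      have hadd := U.finrank_quotient_add_finrank
      have hpos := Submodule.finrank_eq_zero.not.2 hbot
      omega
    obtain ⟨c, hc⟩ := ih _ finrank_sub_lt (hρ.subrepresentation U hU) rfl
    obtain ⟨d, hd⟩ := ih _ finrank_quotient_lt (hρ.quotient U hU) rfl
    refine ⟨c + d, funext fun g => ?_⟩
    rw [map_add, hc, hd]
    exact (trace_eq_trace_restrict_add_trace_mapQ U (ρ g) (hU g)).symm

end HasContinuousCoeff

namespace Irr

variable {G : Type*} [Group G] [TopologicalSpace G] [IsTopologicalGroup G] [CompactSpace G]
  [MeasurableSpace G] [BorelSpace G] (μ : Measure G) [μ.IsMulLeftInvariant]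
  [IsProbabilityMeasure μ]

open scoped Classical in
theorem integral_conj_char_mul_char (φ ψ : Irr G) :
    ∫ g, conj (φ.char g) * ψ.char g ∂μ = if φ = ψ then 1 else 0 := by
  induction φ using Quotient.ind with
  | _ σ =>
    split_ifs with h
    · subst h
      exact σ.hasContinuousCoeff.integral_conj_character_mul_self μ σ.irreducible_rep
    · induction ψ using Quotient.ind with
      | _ ρ =>
        have := σ.irreducible_rep
        have := ρ.irreducible_rep
        have : IsEmpty (σ.rep.Equiv ρ.rep) := ⟨fun e => h (Quotient.sound ⟨e⟩)⟩
        refine (σ.hasContinuousCoeff.integral_conj_character_mul_character μ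
          ρ.hasContinuousCoeff).trans ?_
        rw [Module.finrank_zero_of_subsingleton, Nat.cast_zero]

include μ in
theorem eq_of_isTriv {φ ψ : Irr G} (hφ : φ.IsTriv) (hψ : ψ.IsTriv) : φ = ψ := by
  by_contra hne
  simpa [hne, hφ.char_eq_one, hψ.char_eq_one] using integral_conj_char_mul_char μ φ ψ

theorem integral_conj_charSum_mul_charSum (c d : Irr G →₀ ℝ) :
    ∫ g, conj (charSum c g) * charSum d g ∂μ = ((c.sum fun φ x => x * d φ : ℝ) : ℂ) := by
  classical
  have integrable_term (φ ψ : Irr G) :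
      Integrable (fun g => (c φ * d ψ : ℂ) * (conj (φ.char g) * ψ.char g)) μ :=
    integrable_of_continuous_of_compactSpace (continuous_const.mul
      ((Complex.continuous_conj.comp φ.continuous_char).mul ψ.continuous_char))
  have expansion (g : G) : conj (charSum c g) * charSum d g
      = ∑ φ ∈ c.support, ∑ ψ ∈ d.support, (c φ * d ψ : ℂ) * (conj (φ.char g) * ψ.char g) := by
    simp only [charSum_apply, Finsupp.sum, map_sum, Finset.sum_mul_sum, map_mul,
      Complex.conj_ofReal, mul_mul_mul_comm]
  simp only [expansion]
  rw [integral_finsetSum _ fun φ _ => integrable_finsetSum _ fun ψ _ => integrable_term φ ψ,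
    Finsupp.sum, Complex.ofReal_sum]
  refine Finset.sum_congr rfl fun φ _ => ?_
  rw [integral_finsetSum _ fun ψ _ => integrable_term φ ψ]
  simp only [integral_const_mul, integral_conj_char_mul_char, mul_ite, mul_one, mul_zero,
    Finset.sum_ite_eq, Finsupp.mem_support_iff, Complex.ofReal_mul]
  split_ifs with hφ
  · rfl
  · rw [not_not.1 hφ, Complex.ofReal_zero, mul_zero]

theorem integral_char_mul_conj_apply (φ : Irr G) (g α : G) :
    ∫ h, φ.char (g * (h * α * h⁻¹)) ∂μ = φ.char g * φ.charRatio α := by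
  induction φ using Quotient.ind with
  | _ σ =>
    exact σ.hasContinuousCoeff.integral_character_mul_conj_apply μ σ.irreducible_rep g α

end Irr

end CharSum

section Multiplicity

open MeasureTheory Representation

variable {G : Type*} [Group G] [TopologicalSpace G] [CompactSpace G]

theorem HasContinuousCoeff.character_im_eq_zero {V : Type*} [AddCommGroup V] [Module ℂ V]
    [FiniteDimensional ℂ V] {ρ : Representation ℂ G V} (hρ : HasContinuousCoeff ρ) {α : G}
    (hα : IsConj α α⁻¹) : (ρ.character α).im = 0 := by
  obtain ⟨k, hk⟩ := isConj_iff.1 hα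
  rw [← Complex.conj_eq_iff_im, ← hρ.character_inv, ← hk, char_conj]

namespace Irr

theorem charRatio_im_eq_zero (φ : Irr G) {α : G} (hα : IsConj α α⁻¹) :
    (φ.charRatio α).im = 0 := by
  have char_im_eq_zero : (φ.char α).im = 0 := by
    induction φ using Quotient.ind with
    | _ σ => exact σ.hasContinuousCoeff.character_im_eq_zero hα
  rw [charRatio, Complex.div_natCast_im, char_im_eq_zero, zero_div]

variable [IsTopologicalGroup G] [MeasurableSpace G] [BorelSpace G] (μ : Measure G)
  [μ.IsMulLeftInvariant] [IsProbabilityMeasure μ] {c d : Irr G →₀ ℝ} {u v : G → ℝ}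

theorem integral_mul_eq_finsum (hu : ∀ g, (u g : ℂ) = charSum c g)
    (hv : ∀ g, (v g : ℂ) = charSum d g) :
    ∫ g, u g * v g ∂μ = ∑ᶠ φ, c φ * d φ := by
  have hsum : ∑ᶠ φ, c φ * d φ = c.sum fun φ x => x * d φ :=
    finsum_eq_sum_of_support_subset _ fun φ hφ =>
      Finsupp.mem_support_iff.2 (left_ne_zero_of_mul hφ)
  have hint := integral_conj_charSum_mul_charSum μ c d
  simp only [← hu, ← hv, Complex.conj_ofReal, ← Complex.ofReal_mul] at hint
  rw [integral_complex_ofReal, ← hsum] at hint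
  exact_mod_cast hint

theorem integral_conj_apply_eq_charSum {α : G} (hα : IsConj α α⁻¹)
    (hu : ∀ g, (u g : ℂ) = charSum c g) (g : G) :
    ((∫ h, u (g * (h * α * h⁻¹)) ∂μ : ℝ) : ℂ)
      = charSum ((fun φ : Irr G => (φ.charRatio α).re) • c) g := by
  have charRatio_eq_re (φ : Irr G) : φ.charRatio α = ((φ.charRatio α).re : ℂ) :=
    Complex.ext rfl (by rw [φ.charRatio_im_eq_zero hα, Complex.ofReal_im])
  have support_subset : ((fun φ : Irr G => (φ.charRatio α).re) • c).support ⊆ c.support :=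
    fun φ hφ => by
      rw [Finsupp.mem_support_iff, Finsupp.coe_pointwise_smul, Pi.smul_apply', smul_eq_mul] at hφ
      exact Finsupp.mem_support_iff.2 (right_ne_zero_of_mul hφ)
  have integrable_term (φ : Irr G) :
      Integrable (fun h => (c φ : ℂ) * φ.char (g * (h * α * h⁻¹))) μ :=
    integrable_of_continuous_of_compactSpace
      (continuous_const.mul (φ.continuous_char.comp (by fun_prop)))
  rw [← integral_complex_ofReal]
  simp only [hu, charSum_apply]
  rw [Finsupp.sum_of_support_subset _ support_subset _ (by simp)]
  simp only [Finsupp.sum]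
  rw [integral_finsetSum _ fun φ _ => integrable_term φ]
  refine Finset.sum_congr rfl fun φ _ => ?_
  rw [integral_const_mul, integral_char_mul_conj_apply, charRatio_eq_re,
    Finsupp.coe_pointwise_smul, Pi.smul_apply', smul_eq_mul, Complex.ofReal_mul]
  ring

variable {V : Type*} [AddCommGroup V] [Module ℂ V] [FiniteDimensional ℂ V]
  {ρ : Representation ℂ G V}

theorem integral_conj_char_mul_character (hρ : HasContinuousCoeff ρ) (φ : Irr G) :
    ∫ g, conj (φ.char g) * ρ.character g ∂μ = φ.mult ρ := by
  induction φ using Quotient.ind with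
  | _ σ => exact σ.hasContinuousCoeff.integral_conj_character_mul_character μ hρ

include μ in
theorem exists_finsupp_mult_charSum_eq_character (hρ : HasContinuousCoeff ρ) :
    ∃ m : Irr G →₀ ℝ, (∀ φ, m φ = φ.mult ρ) ∧ charSum m = ρ.character := by
  obtain ⟨m, hm⟩ := hρ.exists_charSum_eq_character
  refine ⟨m, fun φ => ?_, hm⟩
  have hint := integral_conj_charSum_mul_charSum μ (Finsupp.single φ 1) m
  simp only [charSum_single, Complex.ofReal_one, one_mul, hm] at hint
  rw [integral_conj_char_mul_character μ hρ φ, Finsupp.sum_single_index (zero_mul _),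
    one_mul] at hint
  exact_mod_cast hint.symm

end Irr

end Multiplicity

section SymmTrace

open MeasureTheory Representation

variable {G V : Type*} [Group G] [AddCommGroup V] [Module ℂ V]

theorem symmTrace_eq_sqrt_two_mul_re (τ : Representation ℂ G V) (g : G) :
    τ.symmTrace g = √2 * (τ.character g).re := by
  rw [symmTrace, Complex.add_conj, Complex.ofReal_re, mul_div_right_comm, Real.div_sqrt]

theorem symmTrace_sq (τ : Representation ℂ G V) (g : G) :
    τ.symmTrace g ^ 2 = (τ.character g ^ 2 + conj (τ.character g) * τ.character g).re := by
  rw [symmTrace_eq_sqrt_two_mul_re, mul_pow, Real.sq_sqrt zero_le_two]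
  simp only [sq, Complex.add_re, Complex.mul_re, Complex.conj_re, Complex.conj_im]
  ring

variable [FiniteDimensional ℂ V]

theorem character_sumConjSq (τ : Representation ℂ G V) (g : G) :
    τ.sumConjSq.character g = (τ.character g + conj (τ.character g)) ^ 2 := by
  have character_prod : (τ.prod τ.conjRep).character g
      = τ.character g + conj (τ.character g) := by
    rw [← character_conjRep]
    exact LinearMap.trace_prodMap' (τ g) (τ.conjRep g)
  rw [sumConjSq, char_tensor, Pi.mul_apply, character_prod, sq]

theorem ofReal_symmTrace_sq (τ : Representation ℂ G V) (g : G) :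
    ((τ.symmTrace g ^ 2 : ℝ) : ℂ) = 1 / 2 * τ.sumConjSq.character g := by
  rw [symmTrace_eq_sqrt_two_mul_re, mul_pow, Real.sq_sqrt zero_le_two, character_sumConjSq,
    Complex.add_conj]
  push_cast
  ring

namespace HasContinuousCoeff

variable [TopologicalSpace G] {τ : Representation ℂ G V}

theorem sumConjSq (hτ : HasContinuousCoeff τ) : HasContinuousCoeff τ.sumConjSq :=
  (hτ.prod hτ.conjRep).tprod (hτ.prod hτ.conjRep)

theorem continuous_symmTrace (hτ : HasContinuousCoeff τ) : Continuous τ.symmTrace := by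
  rw [funext (symmTrace_eq_sqrt_two_mul_re τ)]
  exact continuous_const.mul (Complex.continuous_re.comp hτ.continuous_character)

variable [IsTopologicalGroup G] [CompactSpace G] [MeasurableSpace G] [BorelSpace G]
  (μ : Measure G) [μ.IsMulLeftInvariant] [IsProbabilityMeasure μ]

theorem integral_symmTrace_mul_conj_apply (hτ : HasContinuousCoeff τ) (hirr : τ.IsIrreducible)
    {α : G} {a : ℝ} (ha : τ.character α / (Module.finrank ℂ V : ℂ) = ((1 - a : ℝ) : ℂ)) (g : G) :
    ∫ h, τ.symmTrace (g * (h * α * h⁻¹)) ∂μ = (1 - a) * τ.symmTrace g := by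
  have hχ : Continuous fun h => τ.character (g * (h * α * h⁻¹)) :=
    hτ.continuous_character.comp (by fun_prop)
  simp only [symmTrace_eq_sqrt_two_mul_re]
  rw [integral_const_mul]
  have hre := integral_re (𝕜 := ℂ) (integrable_of_continuous_of_compactSpace (μ := μ) hχ)
  rw [hτ.integral_character_mul_conj_apply μ hirr, ha] at hre
  refine (congrArg (√2 * ·) hre).trans ?_
  simp only [RCLike.re_eq_complex_re, Complex.re_mul_ofReal]
  ring

theorem integral_symmTrace_sq (hτ : HasContinuousCoeff τ) (hirr : τ.IsIrreducible)
    (hnonreal : ∃ g, (τ.character g).im ≠ 0) : ∫ g, τ.symmTrace g ^ 2 ∂μ = 1 := by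
  have hχ := hτ.continuous_character
  have integrable_sq : Integrable (fun g => τ.character g ^ 2) μ :=
    integrable_of_continuous_of_compactSpace (hχ.pow 2)
  have integrable_conj_mul : Integrable (fun g => conj (τ.character g) * τ.character g) μ :=
    integrable_of_continuous_of_compactSpace ((Complex.continuous_conj.comp hχ).mul hχ)
  have hre := integral_re (𝕜 := ℂ) (integrable_sq.fun_add integrable_conj_mul)
  rw [integral_add integrable_sq integrable_conj_mul,
    hτ.integral_character_sq_eq_zero μ hirr hnonreal, hτ.integral_conj_character_mul_self μ hirr,
    zero_add] at hre
  simpa only [symmTrace_sq, RCLike.re_eq_complex_re, Complex.one_re] using hre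

include μ in
theorem mult_sumConjSq_of_isTriv (hτ : HasContinuousCoeff τ) (hirr : τ.IsIrreducible)
    (hnonreal : ∃ g, (τ.character g).im ≠ 0) {φ : Irr G} (hφ : φ.IsTriv) :
    φ.mult τ.sumConjSq = 2 := by
  have hint := Irr.integral_conj_char_mul_character μ hτ.sumConjSq φ
  have integrand_eq (g : G) : conj (φ.char g) * τ.sumConjSq.character g
      = ((2 * τ.symmTrace g ^ 2 : ℝ) : ℂ) := by
    rw [hφ.char_eq_one, Complex.ofReal_mul, ofReal_symmTrace_sq, map_one]
    push_cast
    ring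
  simp only [integrand_eq] at hint
  rw [integral_complex_ofReal, integral_const_mul, hτ.integral_symmTrace_sq μ hirr hnonreal,
    mul_one] at hint
  exact_mod_cast hint.symm

end HasContinuousCoeff

end SymmTrace

section RandomWalk

open MeasureTheory ProbabilityTheory

theorem condExp_comap_fst_ae_eq {Ω Ω' : Type*} [mΩ : MeasurableSpace Ω] [MeasurableSpace Ω']
    {μ : Measure Ω} {ν : Measure Ω'} [IsProbabilityMeasure μ] [IsProbabilityMeasure ν]
    {f : Ω × Ω' → ℝ} (hf : Integrable f (μ.prod ν)) :
    (μ.prod ν)[f|mΩ.comap Prod.fst] =ᵐ[μ.prod ν] fun p => ∫ y, f (p.1, y) ∂ν := by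
  have integrable_fiber : Integrable (fun p : Ω × Ω' => ∫ y, f (p.1, y) ∂ν) (μ.prod ν) :=
    hf.integral_prod_left.comp_fst ν
  refine (ae_eq_condExp_of_forall_setIntegral_eq measurable_fst.comap_le hf
    (fun _ _ _ => integrable_fiber.integrableOn) ?_ ?_).symm
  · rintro _ ⟨t, -, rfl⟩ -
    rw [← Set.prod_univ, setIntegral_prod _ integrable_fiber.integrableOn,
      setIntegral_prod _ hf.integrableOn]
    simp only [Measure.restrict_univ, integral_const, probReal_univ, one_smul]
  · have hmeas := hf.integral_prod_left.aestronglyMeasurable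
    exact ⟨_, hmeas.stronglyMeasurable_mk.comp_measurable (comap_measurable Prod.fst),
      Measure.quasiMeasurePreserving_fst.ae_eq_comp hmeas.ae_eq_mk⟩

variable {G : Type*} [Group G]

/-- The end point of a step of the random walk on `G` whose steps are uniform in the conjugacy
class of `α`: from `p.1`, with the step obtained by conjugating `α` by `p.2`. -/
def randomStep (α : G) (p : G × G) : G := p.1 * (p.2 * α * p.2⁻¹)

theorem randomStep_randomStep {α k : G} (hk : k * α * k⁻¹ = α⁻¹) (p : G × G) :
    randomStep α (randomStep α p, p.2 * k) = p.1 := by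
  have conj_mul : p.2 * k * α * (p.2 * k)⁻¹ = p.2 * α⁻¹ * p.2⁻¹ := by
    rw [← hk]
    group
  simp only [randomStep, conj_mul]
  group

variable [TopologicalSpace G] [IsTopologicalGroup G]

theorem continuous_randomStep (α : G) : Continuous (randomStep α) := by
  unfold randomStep
  fun_prop

variable [CompactSpace G] [MeasurableSpace G] [BorelSpace G] (μ : Measure G) [μ.IsHaarMeasure]
  [IsProbabilityMeasure μ]

theorem isMulRightInvariant_of_compactSpace : μ.IsMulRightInvariant where
  map_mul_right_eq_self g := by
    have : IsProbabilityMeasure (μ.map (· * g)) :=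
      Measure.isProbabilityMeasure_map (by fun_prop)
    exact Measure.isHaarMeasure_eq_of_isProbabilityMeasure _ _

variable [SecondCountableTopology G]

theorem measurePreserving_randomStep_mul_right (α k : G) :
    MeasurePreserving (fun p : G × G => (randomStep α p, p.2 * k)) (μ.prod μ) (μ.prod μ) := by
  have := isMulRightInvariant_of_compactSpace μ
  have skew : MeasurePreserving (fun q : G × G => (q.1 * k, randomStep α (q.2, q.1)))
      (μ.prod μ) (μ.prod μ) :=
    (measurePreserving_mul_right μ k).skew_product (g := fun h g => randomStep α (g, h))
      ((continuous_randomStep α).comp continuous_swap).measurable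
      (.of_forall fun h => map_mul_right_eq_self μ (h * α * h⁻¹))
  exact Measure.measurePreserving_swap.comp (skew.comp Measure.measurePreserving_swap)

theorem identDistrib_randomStep_swap {α : G} (hα : IsConj α α⁻¹) :
    IdentDistrib (fun p => (p.1, randomStep α p)) (fun p => (randomStep α p, p.1))
      (μ.prod μ) (μ.prod μ) := by
  obtain ⟨k, hk⟩ := isConj_iff.1 hα
  have hpres := measurePreserving_randomStep_mul_right μ α k
  have hmeas := (continuous_randomStep α).measurable
  refine ⟨(measurable_fst.prodMk hmeas).aemeasurable, (hmeas.prodMk measurable_fst).aemeasurable,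
    ?_⟩
  conv_lhs => rw [← hpres.map_eq]
  rw [Measure.map_map (measurable_fst.prodMk hmeas) hpres.measurable]
  simp only [Function.comp_def, randomStep_randomStep hk]

variable {V : Type*} [AddCommGroup V] [Module ℂ V] [FiniteDimensional ℂ V]
  {τ : Representation ℂ G V}

theorem HasContinuousCoeff.isSteinPair_symmTrace (hτ : HasContinuousCoeff τ)
    (hirr : τ.IsIrreducible) (hnonreal : ∃ g, (τ.character g).im ≠ 0) {α : G}
    (hα : IsConj α α⁻¹) {a : ℝ}
    (ha : τ.character α / (Module.finrank ℂ V : ℂ) = ((1 - a : ℝ) : ℂ)) :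
    IsSteinPair (MeasurableSpace.comap Prod.fst ‹_›) (μ.prod μ)
      (fun p => τ.symmTrace p.1) (fun p => τ.symmTrace (randomStep α p)) a where
  le := measurable_fst.comap_le
  stronglyMeasurable_fst :=
    hτ.continuous_symmTrace.stronglyMeasurable.comp_measurable (comap_measurable Prod.fst)
  memLp_fst :=
    (hτ.continuous_symmTrace.comp continuous_fst).memLp_of_hasCompactSupport
      (.of_compactSpace _)
  identDistrib_swap :=
    (identDistrib_randomStep_swap μ hα).comp
      (u := fun p : G × G => (τ.symmTrace p.1, τ.symmTrace p.2))
      ((hτ.continuous_symmTrace.measurable.comp measurable_fst).prodMk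
        (hτ.continuous_symmTrace.measurable.comp measurable_snd))
  condExp_snd := by
    have integrable_snd : Integrable (fun p => τ.symmTrace (randomStep α p)) (μ.prod μ) :=
      integrable_of_continuous_of_compactSpace
        (hτ.continuous_symmTrace.comp (continuous_randomStep α))
    refine (condExp_comap_fst_ae_eq integrable_snd).trans (.of_forall fun p => ?_)
    exact hτ.integral_symmTrace_mul_conj_apply μ hirr ha p.1
  integral_sq_fst := by
    rw [integral_fun_fst fun g => τ.symmTrace g ^ 2, probReal_univ, one_smul,
      hτ.integral_symmTrace_sq μ hirr hnonreal]

end RandomWalk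

section StepMoments

open MeasureTheory ProbabilityTheory

theorem cdf_gaussianReal_zero_one_eq (x : ℝ) : cdf (gaussianReal 0 1) x
    = 1 / √(2 * Real.pi) * ∫ t in Set.Iic x, Real.exp (-t ^ 2 / 2) := by
  rw [cdf_eq_real, ← integral_indicator_one measurableSet_Iic,
    integral_indicator measurableSet_Iic, setIntegral_gaussianReal one_ne_zero,
    ← integral_const_mul]
  simp [gaussianPDFReal]

theorem measureReal_setOf_le_eq_cdf_map_fst {Ω Ω' : Type*} [MeasurableSpace Ω]
    [MeasurableSpace Ω'] (μ : Measure Ω) (ν : Measure Ω') [IsProbabilityMeasure μ]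
    [IsProbabilityMeasure ν] {W : Ω → ℝ} (hW : Measurable W) (x : ℝ) :
    μ.real {y | W y ≤ x} = cdf ((μ.prod ν).map fun p => W p.1) x := by
  have : IsProbabilityMeasure ((μ.prod ν).map fun p => W p.1) :=
    Measure.isProbabilityMeasure_map (hW.comp measurable_fst).aemeasurable
  rw [cdf_eq_real, ← Function.comp_def W, ← Measure.map_map hW measurable_fst,
    Measure.map_fst_prod, measure_univ, one_smul, map_measureReal_apply hW measurableSet_Iic]
  rfl

variable {G : Type*} [Group G] [TopologicalSpace G] [IsTopologicalGroup G] [CompactSpace G]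
  [MeasurableSpace G] [BorelSpace G] (μ : Measure G)

section Invariant

variable [μ.IsMulLeftInvariant] [IsProbabilityMeasure μ]
  {V : Type*} [AddCommGroup V] [Module ℂ V] [FiniteDimensional ℂ V]

include μ in
theorem Irr.finite_setOf_mult_ne_zero {ρ : Representation ℂ G V} (hρ : HasContinuousCoeff ρ) :
    {φ : Irr G | φ.mult ρ ≠ 0}.Finite := by
  obtain ⟨m, hm, -⟩ := exists_finsupp_mult_charSum_eq_character μ hρ
  refine m.hasFiniteSupport.subset fun φ hφ => ?_
  rw [Function.mem_support, hm]
  exact Nat.cast_ne_zero.2 hφ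

namespace HasContinuousCoeff

variable {τ : Representation ℂ G V} {α : G} {a : ℝ}

include μ in
theorem exists_charSum_eq_symmTrace_sq (hτ : HasContinuousCoeff τ) : ∃ c : Irr G →₀ ℝ,
    (∀ φ, c φ = φ.mult τ.sumConjSq / 2) ∧
      ∀ g, ((τ.symmTrace g ^ 2 : ℝ) : ℂ) = Irr.charSum c g := by
  obtain ⟨m, hm, hchar⟩ := Irr.exists_finsupp_mult_charSum_eq_character μ hτ.sumConjSq
  refine ⟨(1 / 2 : ℝ) • m, fun φ => ?_, fun g => ?_⟩
  · rw [Finsupp.smul_apply, hm, smul_eq_mul, one_div_mul_eq_div]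
  · rw [ofReal_symmTrace_sq, map_smul, hchar, Pi.smul_apply, Complex.real_smul]
    push_cast
    rfl

theorem integral_sq_symmTrace_sub (hτ : HasContinuousCoeff τ) (hirr : τ.IsIrreducible)
    (ha : τ.character α / (Module.finrank ℂ V : ℂ) = ((1 - a : ℝ) : ℂ)) (g : G) :
    ∫ h, (τ.symmTrace (g * (h * α * h⁻¹)) - τ.symmTrace g) ^ 2 ∂μ
      = (∫ h, τ.symmTrace (g * (h * α * h⁻¹)) ^ 2 ∂μ) + (2 * a - 1) * τ.symmTrace g ^ 2 := by
  have continuous_step : Continuous fun h => τ.symmTrace (g * (h * α * h⁻¹)) :=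
    hτ.continuous_symmTrace.comp (by fun_prop)
  have integrable_sq : Integrable (fun h => τ.symmTrace (g * (h * α * h⁻¹)) ^ 2) μ :=
    integrable_of_continuous_of_compactSpace (continuous_step.pow 2)
  have integrable_mul : Integrable
      (fun h => 2 * τ.symmTrace (g * (h * α * h⁻¹)) * τ.symmTrace g) μ :=
    integrable_of_continuous_of_compactSpace ((continuous_step.const_mul 2).mul_const _)
  have integrable_sub : Integrable (fun h => τ.symmTrace (g * (h * α * h⁻¹)) ^ 2
      - 2 * τ.symmTrace (g * (h * α * h⁻¹)) * τ.symmTrace g) μ :=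
    integrable_sq.sub integrable_mul
  simp only [sub_sq]
  rw [integral_add integrable_sub (integrable_const _),
    integral_sub integrable_sq integrable_mul, integral_mul_const, integral_const_mul,
    hτ.integral_symmTrace_mul_conj_apply μ hirr ha, integral_const, probReal_univ, one_smul]
  ring

theorem integral_sq_one_sub_integral_sq_symmTrace_sub (hτ : HasContinuousCoeff τ)
    (hirr : τ.IsIrreducible) (hnonreal : ∃ g, (τ.character g).im ≠ 0) (hα : IsConj α α⁻¹)
    (ha : τ.character α / (Module.finrank ℂ V : ℂ) = ((1 - a : ℝ) : ℂ)) (ha_ne : a ≠ 0) :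
    ∫ g, (1 - (∫ h, (τ.symmTrace (g * (h * α * h⁻¹)) - τ.symmTrace g) ^ 2 ∂μ) / (2 * a)) ^ 2 ∂μ
      = 1 / 16 * ∑ᶠ (φ : Irr G) (_ : ¬ φ.IsTriv), (φ.mult τ.sumConjSq : ℝ) ^ 2
          * (2 - 1 / a * (1 - (φ.charRatio α).re)) ^ 2 := by
  obtain ⟨c, hc, hcsum⟩ := hτ.exists_charSum_eq_symmTrace_sq μ
  obtain ⟨φ₀, hφ₀⟩ := Irr.exists_isTriv (G := G)
  let e : Irr G →₀ ℝ := Finsupp.single φ₀ 1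
    - (1 / (2 * a)) • ((fun φ : Irr G => (φ.charRatio α).re) • c + (2 * a - 1) • c)
  have charSum_e (g : G) : ((1 - (∫ h, (τ.symmTrace (g * (h * α * h⁻¹)) - τ.symmTrace g) ^ 2 ∂μ)
      / (2 * a) : ℝ) : ℂ) = Irr.charSum e g := by
    simp only [e, map_sub, map_smul, map_add, Pi.sub_apply, Pi.smul_apply, Pi.add_apply,
      ← Irr.integral_conj_apply_eq_charSum μ hα hcsum, ← hcsum, Irr.charSum_single,
      hφ₀.char_eq_one, hτ.integral_sq_symmTrace_sub μ hirr ha, Complex.real_smul]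
    push_cast
    ring
  rw [← smul_eq_mul (1 / 16 : ℝ), smul_finsum]
  simp only [sq (1 - _ : ℝ)]
  rw [Irr.integral_mul_eq_finsum μ charSum_e charSum_e]
  refine finsum_congr fun φ => ?_
  have e_apply : e φ = Finsupp.single φ₀ 1 φ
      - 1 / 4 * (φ.mult τ.sumConjSq * (2 - 1 / a * (1 - (φ.charRatio α).re))) := by
    simp only [e, Finsupp.sub_apply, Finsupp.smul_apply, Finsupp.add_apply, smul_eq_mul,
      Finsupp.coe_pointwise_smul, Pi.smul_apply', hc]
    field_simp
    ring
  classical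
  rw [finsum_eq_if, e_apply]
  by_cases hφ : φ.IsTriv
  · obtain rfl := Irr.eq_of_isTriv μ hφ hφ₀
    rw [if_neg (not_not.2 hφ), hτ.mult_sumConjSq_of_isTriv μ hirr hnonreal hφ,
      hφ.charRatio_eq_one, Finsupp.single_eq_same]
    norm_num
  · rw [if_pos hφ, Finsupp.single_eq_of_ne (by rintro rfl; exact hφ hφ₀), smul_eq_mul]
    ring

end HasContinuousCoeff

end Invariant

variable [SecondCountableTopology G] [μ.IsHaarMeasure] [IsProbabilityMeasure μ]
  {V : Type*} [AddCommGroup V] [Module ℂ V] [FiniteDimensional ℂ V]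
  {τ : Representation ℂ G V} {α : G} {a : ℝ}

theorem HasContinuousCoeff.integral_symmTrace_sub_pow_four (hτ : HasContinuousCoeff τ)
    (hirr : τ.IsIrreducible) (hnonreal : ∃ g, (τ.character g).im ≠ 0) (hα : IsConj α α⁻¹)
    (ha : τ.character α / (Module.finrank ℂ V : ℂ) = ((1 - a : ℝ) : ℂ)) (ha_ne : a ≠ 0) :
    ∫ p, (τ.symmTrace (randomStep α p) - τ.symmTrace p.1) ^ 4 ∂μ.prod μ
      = a * ∑ᶠ φ : Irr G, (φ.mult τ.sumConjSq : ℝ) ^ 2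
          * (2 - 3 / (2 * a) * (1 - (φ.charRatio α).re)) := by
  obtain ⟨c, hc, hcsum⟩ := hτ.exists_charSum_eq_symmTrace_sq μ
  let d : Irr G →₀ ℝ := (8 * a - 6) • c + (6 : ℝ) • (fun φ : Irr G => (φ.charRatio α).re) • c
  have charSum_d (g : G) : (((8 * a - 6) * τ.symmTrace g ^ 2
      + 6 * ∫ h, τ.symmTrace (g * (h * α * h⁻¹)) ^ 2 ∂μ : ℝ) : ℂ) = Irr.charSum d g := by
    simp only [d, map_add, map_smul, Pi.add_apply, Pi.smul_apply, ← hcsum,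
      ← Irr.integral_conj_apply_eq_charSum μ hα hcsum, Complex.real_smul]
    push_cast
    rfl
  have integrable_fst : Integrable (fun g : G => τ.symmTrace g ^ 4) μ :=
    integrable_of_continuous_of_compactSpace (hτ.continuous_symmTrace.pow 4)
  have integrable_mul : Integrable
      (fun p => τ.symmTrace p.1 ^ 2 * τ.symmTrace (randomStep α p) ^ 2) (μ.prod μ) :=
    integrable_of_continuous_of_compactSpace <|
      ((hτ.continuous_symmTrace.comp continuous_fst).pow 2).mul
        ((hτ.continuous_symmTrace.comp (continuous_randomStep α)).pow 2)
  calc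
    _ = (8 * a - 6) * ∫ p : G × G, τ.symmTrace p.1 ^ 4 ∂μ.prod μ
        + 6 * ∫ p, τ.symmTrace p.1 ^ 2 * τ.symmTrace (randomStep α p) ^ 2 ∂μ.prod μ :=
      (hτ.isSteinPair_symmTrace μ hirr hnonreal hα ha).integral_sub_pow_four
    _ = ∫ g, τ.symmTrace g ^ 2 * ((8 * a - 6) * τ.symmTrace g ^ 2
          + 6 * ∫ h, τ.symmTrace (g * (h * α * h⁻¹)) ^ 2 ∂μ) ∂μ := by
      rw [integral_fun_fst fun g => τ.symmTrace g ^ 4, probReal_univ, one_smul,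
        integral_prod _ integrable_mul, ← integral_const_mul, ← integral_const_mul,
        ← integral_add (integrable_fst.const_mul _) (integrable_mul.integral_prod_left.const_mul _)]
      simp only [integral_const_mul, randomStep]
      exact integral_congr_ae (.of_forall fun g => by ring)
    _ = _ := by
      rw [Irr.integral_mul_eq_finsum μ hcsum charSum_d, ← smul_eq_mul a, smul_finsum]
      refine finsum_congr fun φ => ?_
      simp only [d, Finsupp.add_apply, Finsupp.smul_apply, Finsupp.coe_pointwise_smul,
        Pi.smul_apply', hc, smul_eq_mul]
      field_simp
      ring

theorem HasContinuousCoeff.integral_sq_one_sub_condExp (hτ : HasContinuousCoeff τ)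
    (hirr : τ.IsIrreducible) (hnonreal : ∃ g, (τ.character g).im ≠ 0) (hα : IsConj α α⁻¹)
    (ha : τ.character α / (Module.finrank ℂ V : ℂ) = ((1 - a : ℝ) : ℂ)) (ha_ne : a ≠ 0) :
    ∫ p, (1 - ((μ.prod μ)[fun p => (τ.symmTrace (randomStep α p) - τ.symmTrace p.1) ^ 2|
        MeasurableSpace.comap Prod.fst ‹_›]) p / (2 * a)) ^ 2 ∂μ.prod μ
      = 1 / 16 * ∑ᶠ (φ : Irr G) (_ : ¬ φ.IsTriv), (φ.mult τ.sumConjSq : ℝ) ^ 2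
          * (2 - 1 / a * (1 - (φ.charRatio α).re)) ^ 2 := by
  have integrable_sq : Integrable
      (fun p => (τ.symmTrace (randomStep α p) - τ.symmTrace p.1) ^ 2) (μ.prod μ) :=
    integrable_of_continuous_of_compactSpace
      (((hτ.continuous_symmTrace.comp (continuous_randomStep α)).sub
        (hτ.continuous_symmTrace.comp continuous_fst)).pow 2)
  rw [← hτ.integral_sq_one_sub_integral_sq_symmTrace_sub μ hirr hnonreal hα ha ha_ne]
  refine (integral_congr_ae ?_).trans ((integral_fun_fst _).trans
    (by rw [probReal_univ, one_smul]))
  filter_upwards [condExp_comap_fst_ae_eq integrable_sq] with p hp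
  rw [hp]
  rfl

end StepMoments

open MeasureTheory in
theorem mainTheorem2_general {G : Type*} [Group G] [TopologicalSpace G] [IsTopologicalGroup G]
    [CompactSpace G] [SecondCountableTopology G] [MeasurableSpace G] [BorelSpace G]
    (μ : Measure G) [μ.IsHaarMeasure] [IsProbabilityMeasure μ]
    {V : Type*} [AddCommGroup V] [Module ℂ V] [FiniteDimensional ℂ V]
    {τ : Representation ℂ G V} (hτ : HasContinuousCoeff τ) (hτ_irr : τ.IsIrreducible)
    (hτ_nonreal : ∃ g : G, (τ.character g).im ≠ 0) {α : G} (hα : IsConj α α⁻¹)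
    {a : ℝ} (ha : a = 1 - (τ.character α / (Module.finrank ℂ V : ℂ)).re) (ha_ne : a ≠ 0) :
    (τ.character α).im = 0 ∧
    (∀ φ : Irr G, (φ.charRatio α).im = 0) ∧
    {φ : Irr G | φ.mult τ.sumConjSq ≠ 0}.Finite ∧
    ∀ x₀ : ℝ,
      |μ.real {g : G | τ.symmTrace g ≤ x₀}
          - 1 / √(2 * Real.pi) * ∫ x in Set.Iic x₀, Real.exp (-x ^ 2 / 2)|
        ≤ 1 / 2 * √(∑ᶠ (φ : Irr G) (_ : ¬ φ.IsTriv),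
              (φ.mult τ.sumConjSq : ℝ) ^ 2
                * (2 - 1 / a * (1 - (φ.charRatio α).re)) ^ 2)
          + (1 / Real.pi * ∑ᶠ φ : Irr G,
              (φ.mult τ.sumConjSq : ℝ) ^ 2
                * (2 - 3 / (2 * a) * (1 - (φ.charRatio α).re))) ^ (1 / 4 : ℝ) := by
  have him := hτ.character_im_eq_zero hα
  refine ⟨him, fun φ => φ.charRatio_im_eq_zero hα, Irr.finite_setOf_mult_ne_zero μ hτ.sumConjSq,
    fun x₀ => ?_⟩
  have ratio_eq : τ.character α / (Module.finrank ℂ V : ℂ) = ((1 - a : ℝ) : ℂ) :=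
    Complex.ext (by rw [Complex.ofReal_re, ha, sub_sub_cancel])
      (by rw [Complex.ofReal_im, Complex.div_natCast_im, him, zero_div])
  have hpair := hτ.isSteinPair_symmTrace μ hτ_irr hτ_nonreal hα ratio_eq
  have one_div_sixteen_nonneg : (0 : ℝ) ≤ 1 / 16 := by norm_num
  have sqrt_one_div_sixteen : √(1 / 16 : ℝ) = 1 / 4 := by
    rw [Real.sqrt_eq_iff_mul_self_eq] <;> norm_num
  have hbound := hpair.abs_cdf_map_sub_cdf_gaussianReal_le ha_ne x₀
  rw [hτ.integral_sq_one_sub_condExp μ hτ_irr hτ_nonreal hα ratio_eq ha_ne,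
    hτ.integral_symmTrace_sub_pow_four μ hτ_irr hτ_nonreal hα ratio_eq ha_ne,
    ← measureReal_setOf_le_eq_cdf_map_fst μ μ hτ.continuous_symmTrace.measurable,
    cdf_gaussianReal_zero_one_eq,
    Real.sqrt_mul one_div_sixteen_nonneg, sqrt_one_div_sixteen] at hbound
  convert hbound using 2
  · ring
  · congr 1
    field_simp

end

theorem mainTheorem2 {d : ℕ} {G : Type*} [Group G] [TopologicalSpace G] [T2Space G]
    [CompactSpace G] [ChartedSpace (EuclideanSpace ℝ (Fin d)) G] [LieGroup (𝓡 d) ∞ G]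
    [MeasurableSpace G] [BorelSpace G]
    (μ : MeasureTheory.Measure G) [μ.IsHaarMeasure] [MeasureTheory.IsProbabilityMeasure μ]
    {V : Type*} [AddCommGroup V] [Module ℂ V] [FiniteDimensional ℂ V]
    [TopologicalSpace V] [IsTopologicalAddGroup V] [ContinuousSMul ℂ V] [T2Space V]
    (τ : Representation ℂ G V) (hτ_cont : τ.IsContinuousAction) (hτ_irr : τ.IsIrreducible)
    (hτ_nonreal : ∃ g : G, (τ.character g).im ≠ 0)
    (α : G) (hα_one : α ≠ 1) (hα_conj : IsConj α α⁻¹)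
    (a : ℝ) (ha : a = 1 - (τ.character α / (Module.finrank ℂ V : ℂ)).re) (ha_ne : a ≠ 0) :
    (τ.character α).im = 0 ∧
    (∀ φ : Irr G, (φ.charRatio α).im = 0) ∧
    {φ : Irr G | φ.mult τ.sumConjSq ≠ 0}.Finite ∧
    ∀ x₀ : ℝ,
      |μ.real {g : G | τ.symmTrace g ≤ x₀}
          - 1 / √(2 * Real.pi) * ∫ x in Set.Iic x₀, Real.exp (-x ^ 2 / 2)|
        ≤ 1 / 2 * √(∑ᶠ (φ : Irr G) (_ : ¬ φ.IsTriv),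
              (φ.mult τ.sumConjSq : ℝ) ^ 2
                * (2 - 1 / a * (1 - (φ.charRatio α).re)) ^ 2)
          + (1 / Real.pi * ∑ᶠ φ : Irr G,
              (φ.mult τ.sumConjSq : ℝ) ^ 2
                * (2 - 3 / (2 * a) * (1 - (φ.charRatio α).re))) ^ (1 / 4 : ℝ) := by
  have : IsTopologicalGroup G := topologicalGroup_of_lieGroup (𝓡 d) ∞
  have : SecondCountableTopology G :=
    ChartedSpace.secondCountable_of_sigmaCompact (EuclideanSpace ℝ (Fin d)) G
  exact mainTheorem2_general μ (.of_isContinuousAction hτ_cont) hτ_irr hτ_nonreal hα_conj ha ha_ne
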